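/- **Theorem 1 (generalization error of distributed kernel ridge regression).** Let $\mathcal X$ be a compact metric space, $K:\mathcal X\times\mathcal X\to\mathbb R$ a Mercer kernel (continuous, symmetric, positive semidefinite) and $(\mathcal H_K,\|\cdot\|_K)$ its reproducing kernel Hilbert space. Let $\rho$ be a Borel probability measure on $\mathcal X\times\mathbb R$ with marginal $\rho_X$ on $\mathcal X$ and conditional distributions $\rho(\cdot|x)$, let $f_\rho(x)=\int y\,d\rho(y|x)$ be the regression function, $\|\cdot\|_\rho$ the norm of $L^2_{\rho_X}$, $L_K:L^2_{\rho_X}\to L^2_{\rho_X}$ the compact positive operator $L_Kf=\int_{\mathcal X}K(\cdot,x)f(x)\,d\rho_X(x)$, and $\mathcal N(\lambda)=\mathrm{Tr}\big((\lambda I+L_K)^{-1}L_K\big)$, $\lambda>0$, the effective dimension. Assume that 1. there is $M>0$ with $|y|\le M$ almost surely; 2. $f_\rho=L_K^rh_\rho$ for some $h_\rho\in L^2_{\rho_X}$ and some $r$ with $\frac12\le r\le1$; 3. $\mathcal N(\lambda)\le C_0\lambda^{-s}$ for all $\lambda>0$, for some $s\in(0,1]$ and some $C_0\ge1$. Let $m$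 machines hold non-empty samples $D_1,\dots,D_m$, of possibly different sizes $|D_j|$ and with $|D|=\sum_{j=1}^m|D_j|\ge2$, all drawn independently from $\rho$. For $\lambda_j>0$ put $$f_{D_j,\lambda_j}=\arg\min_{f\in\mathcal H_K}\Big\{\frac1{|D_j|}\sum_{(x,y)\in D_j}(f(x)-y)^2+\lambda_j\|f\|_K^2\Big\},\qquad \overline f_{D,\vec\lambda}=\sum_{j=1}^m\frac{|D_j|}{|D|}f_{D_j,\lambda_j}.$$ Then for every constant $C_1>0$ there is a constant $C_2>0$, independent of $m$ and of the sample sizes $|D|,|D_1|,\dots,|D_m|$, such that, whenever $$\lambda_j=C_1\begin{cases}|D|^{-\frac1{2r+s}},&\text{if }|D_j|\ge|D|^{\frac1{2r+s}}\log^4|D|,\\ |D_j|^{-1}\log^4|D|,&\text{otherwise},\end{cases}\qquad(1\le j\le m)$$ and $$m\le|D|^{\frac s{2r+s}}(\log|D|)^{-8r},$$ we have $$E\big[\|\overline f_{D,\vec\lambda}-f_\rho\|_\rho^2\big]\le C_2|D|^{-\frac{2r}{2r+s}}.$$ -/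

import Mathlib

open MeasureTheory ProbabilityTheory
open scoped InnerProductSpace ENNReal

namespace DKRR

/-! ### The kernel integral operator on `L²(μ)` -/

section IntegralOperator

variable {X : Type*} [MetricSpace X] [CompactSpace X] [MeasurableSpace X] [BorelSpace X]

/-- The continuous function `x' ↦ K (x, x')`. -/
def kernelSection (K : C(X × X, ℝ)) (x : X) : C(X, ℝ) := K.curry x

theorem integral_eq_inner (K : C(X × X, ℝ)) (μ : Measure X) [IsFiniteMeasure μ]
    (f : Lp ℝ 2 μ) (x : X) :
    ∫ x', K (x, x') * f x' ∂μ
      = ⟪(ContinuousMap.toLp 2 μ ℝ (kernelSection K x) : Lp ℝ 2 μ), f⟫_ℝ := by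
  rw [L2.inner_def]
  refine integral_congr_ae ?_
  filter_upwards [ContinuousMap.coeFn_toLp (p := 2) μ (𝕜 := ℝ) (kernelSection K x)] with y hy
  rw [hy]
  simp [kernelSection, mul_comm]

theorem continuous_integral (K : C(X × X, ℝ)) (μ : Measure X) [IsFiniteMeasure μ]
    (f : Lp ℝ 2 μ) : Continuous fun x => ∫ x', K (x, x') * f x' ∂μ := by
  simp_rw [integral_eq_inner]
  have h : Continuous (kernelSection K) := K.curry.continuous
  fun_prop

/-- The operator `f ↦ ∫ K(·, x') f(x') dμ(x')` from `L²(μ)` to `C(X)`. -/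
noncomputable def integralToContinuous (K : C(X × X, ℝ)) (μ : Measure X) [IsFiniteMeasure μ] :
    Lp ℝ 2 μ →L[ℝ] C(X, ℝ) :=
  LinearMap.mkContinuous
    { toFun := fun f => ⟨fun x => ∫ x', K (x, x') * f x' ∂μ, continuous_integral K μ f⟩
      map_add' := fun f g => by
        ext x
        simp only [ContinuousMap.coe_mk, ContinuousMap.add_apply, integral_eq_inner,
          inner_add_right]
      map_smul' := fun c f => by
        ext x
        simp only [ContinuousMap.coe_mk, ContinuousMap.smul_apply, integral_eq_inner,
          inner_smul_right, RingHom.id_apply, smul_eq_mul] }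
    (‖(ContinuousMap.toLp 2 μ ℝ : C(X, ℝ) →L[ℝ] Lp ℝ 2 μ)‖ * ‖K‖)
    (fun f => by
      refine (ContinuousMap.norm_le _ (by positivity)).2 fun x => ?_
      simp only [LinearMap.coe_mk, AddHom.coe_mk, ContinuousMap.coe_mk, integral_eq_inner]
      refine (norm_inner_le_norm _ _).trans ?_
      gcongr
      refine (ContinuousLinearMap.le_opNorm _ _).trans ?_
      gcongr
      exact (ContinuousMap.norm_le _ (norm_nonneg _)).2 fun y => K.norm_coe_le_norm (x, y))

/-- The integral operator `L_K : L²(μ) → L²(μ)`, `(L_K f)(x) = ∫ K(x, x') f(x') dμ(x')`. -/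
noncomputable def integralOperator (K : C(X × X, ℝ)) (μ : Measure X) [IsFiniteMeasure μ] :
    Lp ℝ 2 μ →L[ℝ] Lp ℝ 2 μ :=
  (ContinuousMap.toLp 2 μ ℝ).comp (integralToContinuous K μ)

theorem integralOperator_apply_ae (K : C(X × X, ℝ)) (μ : Measure X) [IsFiniteMeasure μ]
    (f : Lp ℝ 2 μ) :
    integralOperator K μ f =ᵐ[μ] fun x => ∫ x', K (x, x') * f x' ∂μ :=
  ContinuousMap.coeFn_toLp (p := 2) μ (𝕜 := ℝ) (integralToContinuous K μ f)

end IntegralOperator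

/-! ### Powers and traces of positive operators on a real Hilbert space -/

section Operators

variable {E : Type*} [NormedAddCommGroup E] [InnerProductSpace ℝ E]

/-- The power `T ^ r` (`r > 0`) of a compact positive operator, through its spectral decomposition:
`T ^ r h = ∑ μ ^ r P_μ h`, where `P_μ` is the orthogonal projection onto the
eigenspace `ker (T - μ)`; only eigenvalues contribute, since `P_μ = 0` for any other `μ`. -/
noncomputable def opPower [CompleteSpace E] (T : E →L[ℝ] E) (r : ℝ) (h : E) : E :=
  ∑' μ : ℝ, μ ^ r • ((T - μ • ContinuousLinearMap.id ℝ E).ker).starProjection h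

/-- The trace, in `[0, ∞]`, of a positive operator `T`: the supremum of `∑ ⟪v, T v⟫` over the finite
orthonormal families. It is the sum of `⟪b i, T (b i)⟫` over any Hilbert basis `b`,
see `positiveTrace_eq_tsum`. -/
noncomputable def positiveTrace (T : E →L[ℝ] E) : ℝ≥0∞ :=
  ⨆ (s : Finset E) (_ : Orthonormal ℝ ((↑) : s → E)), ∑ v ∈ s, ENNReal.ofReal ⟪v, T v⟫_ℝ

theorem sum_inner_le_of_finite {ι : Type*} {T : E →L[ℝ] E} (hT : T.IsPositive)
    {b : ι → E} (hb : Orthonormal ℝ b) (J : Finset ι) (s : Finset E)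
    (hs : Orthonormal ℝ ((↑) : s → E)) :
    ∑ v ∈ s, ⟪∑ i ∈ J, ⟪b i, v⟫_ℝ • b i, T (∑ i ∈ J, ⟪b i, v⟫_ℝ • b i)⟫_ℝ
      ≤ ∑ i ∈ J, ⟪b i, T (b i)⟫_ℝ := by
  classical
  have hexp : ∀ c : J → ℝ, ⟪∑ i, c i • b i, T (∑ i, c i • b i)⟫_ℝ
      = ∑ i, ∑ j, c i * c j * ⟪b i, T (b j)⟫_ℝ := by
    intro c
    simp only [map_sum, map_smul, sum_inner, inner_sum, inner_smul_left, inner_smul_right]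
    rw [Finset.sum_comm]
    refine Finset.sum_congr rfl fun i _ => ?_
    rw [Finset.mul_sum]
    refine Finset.sum_congr rfl fun j _ => ?_
    rw [RCLike.conj_to_real]
    ring
  have hA : (Matrix.of fun i j : J => ⟪b i, T (b j)⟫_ℝ).PosSemidef := by
    refine .of_dotProduct_mulVec_nonneg ?_ fun c => ?_
    · ext i j
      simp only [Matrix.conjTranspose_apply, Matrix.of_apply, star_trivial]
      rw [real_inner_comm]
      exact hT.isSymmetric _ _
    · have h := hT.inner_nonneg_right (∑ i, c i • b i)
      rw [hexp] at h
      convert h using 1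
      simp [dotProduct, Matrix.mulVec, Finset.mul_sum]
      refine Finset.sum_congr rfl fun i _ => Finset.sum_congr rfl fun j _ => by ring
  obtain ⟨κ, w, hw⟩ := Matrix.posSemidef_iff_eq_sum_vecMulVec.1 hA
  have hent : ∀ i j : J, ⟪b i, T (b j)⟫_ℝ = ∑ k, w k i * w k j := by
    intro i j
    have := congrFun (congrFun hw i) j
    simpa [Matrix.sum_apply, Matrix.vecMulVec_apply] using this
  have hterm : ∀ v : E, ⟪∑ i ∈ J, ⟪b i, v⟫_ℝ • b i, T (∑ i ∈ J, ⟪b i, v⟫_ℝ • b i)⟫_ℝ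
      = ∑ k, ⟪v, ∑ i : J, w k i • b i⟫_ℝ ^ 2 := by
    intro v
    rw [← Finset.sum_coe_sort J, hexp fun i : J => ⟪b i, v⟫_ℝ]
    simp_rw [hent, inner_sum, inner_smul_right, Finset.mul_sum, sq, Finset.sum_mul_sum,
      real_inner_comm v]
    rw [Finset.sum_comm_cycle]
    refine Finset.sum_congr rfl fun k _ => Finset.sum_congr rfl fun i _ =>
      Finset.sum_congr rfl fun j _ => by ring
  have hnorm : ∀ k, ‖∑ i : J, w k i • b i‖ ^ 2 = ∑ i : J, w k i ^ 2 := by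
    intro k
    have hb' : Orthonormal ℝ fun i : J => b i := hb.comp _ Subtype.val_injective
    rw [← real_inner_self_eq_norm_sq, hb'.inner_sum]
    simp [sq]
  simp_rw [hterm]
  rw [Finset.sum_comm, ← Finset.sum_coe_sort J]
  simp_rw [hent]
  rw [Finset.sum_comm (s := (Finset.univ : Finset J))]
  refine Finset.sum_le_sum fun k _ => ?_
  simp_rw [← sq]
  rw [← hnorm]
  have := hs.sum_inner_products_le (∑ i : J, w k i • b i) (s := Finset.univ)
  simp only [Real.norm_eq_abs, sq_abs] at this
  rwa [Finset.sum_coe_sort s (fun v => ⟪v, ∑ i : J, w k i • b i⟫_ℝ ^ 2)] at this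

theorem positiveTrace_eq_tsum {ι : Type*} {T : E →L[ℝ] E} (hT : T.IsPositive)
    (b : HilbertBasis ι ℝ E) :
    positiveTrace T = ∑' i, ENNReal.ofReal ⟪b i, T (b i)⟫_ℝ := by
  classical
  refine le_antisymm (iSup₂_le fun s hs => ?_) ?_
  · have hlim : Filter.Tendsto (fun J : Finset ι => ∑ v ∈ s, ENNReal.ofReal
        ⟪∑ i ∈ J, ⟪b i, v⟫_ℝ • b i, T (∑ i ∈ J, ⟪b i, v⟫_ℝ • b i)⟫_ℝ) Filter.atTop
        (nhds (∑ v ∈ s, ENNReal.ofReal ⟪v, T v⟫_ℝ)) := by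
      refine tendsto_finsetSum _ fun v _ => ?_
      have hv : Filter.Tendsto (fun J : Finset ι => ∑ i ∈ J, ⟪b i, v⟫_ℝ • b i) Filter.atTop
          (nhds v) := by
        simpa [HasSum, b.repr_apply_apply] using b.hasSum_repr v
      exact ENNReal.tendsto_ofReal (hv.inner ((T.continuous.tendsto v).comp hv))
    refine le_of_tendsto' hlim fun J => ?_
    rw [← ENNReal.ofReal_sum_of_nonneg fun v _ => hT.inner_nonneg_right _]
    refine (ENNReal.ofReal_le_ofReal (sum_inner_le_of_finite hT b.orthonormal J s hs)).trans ?_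
    rw [ENNReal.ofReal_sum_of_nonneg fun i _ => hT.inner_nonneg_right _]
    exact ENNReal.sum_le_tsum J
  · rw [ENNReal.tsum_eq_iSup_sum]
    refine iSup_le fun J => ?_
    have hinj := b.orthonormal.linearIndependent.injective
    have hmem : ∀ v ∈ Finset.image b J, v ∈ Set.range b := fun v hv => by
      obtain ⟨i, _, hi⟩ := Finset.mem_image.1 hv
      exact ⟨i, hi⟩
    have ho : Orthonormal ℝ (fun v => v : {v // v ∈ Finset.image b J} → E) := by
      refine b.orthonormal.toSubtypeRange.comp
        (fun v : {v // v ∈ Finset.image b J} => (⟨v, hmem v v.2⟩ : Set.range b)) ?_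
      intro v v' h
      exact Subtype.ext (congrArg (fun z : Set.range b => (z : E)) h)
    refine le_trans (le_of_eq ?_) (le_iSup₂ (f := fun (s : Finset E) (_ : Orthonormal ℝ ((↑) : s → E)) =>
      ∑ v ∈ s, ENNReal.ofReal ⟪v, T v⟫_ℝ) (Finset.image b J : Finset E) ho)
    rw [Finset.sum_image fun i _ j _ h => hinj h]

/-- The effective dimension `N(λ) = Tr((λ I + L)⁻¹ L)`. -/
noncomputable def effectiveDimension (L : E →L[ℝ] E) (lam : ℝ) : ℝ≥0∞ :=
  positiveTrace (Ring.inverse (lam • ContinuousLinearMap.id ℝ E + L) * L)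

end Operators

/-! ### Regression function, kernel ridge regression and its distributed version -/

section Regression

variable {X : Type*} [MeasurableSpace X]

/-- The regression function `f_ρ(x) = E[y | X = x] = ∫ y dρ(y | x)`. -/
noncomputable def regressionFunction (ρ : Measure (X × ℝ)) [IsFiniteMeasure ρ] (x : X) : ℝ :=
  ∫ y, y ∂(ρ.condKernel x)

end Regression

section Estimators

variable {X : Type*} (H : Type*) [NormedAddCommGroup H] [InnerProductSpace ℝ H] [RKHS ℝ H X ℝ]

/-- The regularized empirical risk `|D|⁻¹ ∑ (f(x) - y)² + λ ‖f‖_K²` of `f` in the RKHS `H`. -/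
noncomputable def krrObjective {k : ℕ} (D : Fin k → X × ℝ) (lam : ℝ) (f : H) : ℝ :=
  (1 / (k : ℝ)) * ∑ i, (f (D i).1 - (D i).2) ^ 2 + lam * ‖f‖ ^ 2

/-- Kernel ridge regression: the minimizer of the regularized empirical risk over `H`
(it exists and is unique when the sample is non-empty and `λ > 0`). -/
noncomputable def krr {k : ℕ} (D : Fin k → X × ℝ) (lam : ℝ) : H :=
  Classical.epsilon fun f : H => IsMinOn (krrObjective H D lam) Set.univ f

/-- Distributed kernel ridge regression `∑ j, (|D_j| / |D|) f_{D_j, λ_j}`; the `j`-th machine holds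
the `n j` samples `D ⟨j, i⟩`, and `|D| = ∑ j, n j`. -/
noncomputable def dkrr {m : ℕ} (n : Fin m → ℕ) (D : (Σ j : Fin m, Fin (n j)) → X × ℝ)
    (lam : Fin m → ℝ) : H :=
  ∑ j, ((n j : ℝ) / ((∑ i, n i : ℕ) : ℝ)) • krr H (fun i => D ⟨j, i⟩) (lam j)

/-- The squared error `‖f̄ - f_ρ‖_ρ² = ∫ (f̄ - f_ρ)² dρ_X` of distributed kernel ridge
regression on the data `D`, where `ρ_X = ρ.fst` is the marginal distribution of `ρ`. -/
noncomputable def dkrrError [MeasurableSpace X] (ρ : Measure (X × ℝ)) [IsFiniteMeasure ρ]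
    {m : ℕ} (n : Fin m → ℕ) (lam : Fin m → ℝ) (D : (Σ j : Fin m, Fin (n j)) → X × ℝ) : ℝ :=
  ∫ x, (dkrr H n D lam x - regressionFunction ρ x) ^ 2 ∂ρ.fst

end Estimators

/-- The regularization parameter of a machine with `k` of the `N` samples: `C₁ N ^ (-1/(2r+s))` if
`k ≥ N ^ (1/(2r+s)) log⁴ N`, and `C₁ k⁻¹ log⁴ N` otherwise. -/
noncomputable def regParam (C₁ r s : ℝ) (N k : ℕ) : ℝ :=
  if (N : ℝ) ^ (1 / (2 * r + s)) * Real.log N ^ 4 ≤ k then C₁ * (N : ℝ) ^ (-(1 / (2 * r + s)))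
  else C₁ * ((k : ℝ)⁻¹ * Real.log N ^ 4)

end DKRR

/-!
The proof avoids concentration inequalities for operators: it works with expectations only, through
an exchangeability argument.

Let `S : H → L²(μ)` be the inclusion, so that `L_K = S S†`, and let `K_x ∈ H` be the kernel section
at `x`. On a machine holding `n` samples `x_i` with parameter `λ`, put `c = n λ` and
`R = (c I + ∑ K_{x_i} ⊗ K_{x_i})⁻¹`. The normal equations (`krr_eq_ridge`) and a representative
`f ∈ H` of the regression function split the error of the machine into a bias `-c R f` and a noise
term `∑ ε_i R K_{x_i}`, where `ε_i = y_i - f(x_i)` is centered given the inputs.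

* Leave-one-out (`integral_norm_sq_sampleRidge_le`). `‖S R g‖²` is the mean of `⟪K_x, R g⟫²` over a
  fresh point `x`. Adding `x` to the sample changes `⟪K_x, R g⟫` by a factor at most
  `C = 1 + ‖K‖ / c`, by the Sherman–Morrison formula, and then `x` may be exchanged with any sample
  point. Hence `E ‖S R g‖² ≤ (C² / n) E ⟪g, R g⟫`.
* Self-bounding (`integral_inner_sampleRidge_adjoint_le`). For `g = S† w`, one has
  `⟪g, R g⟫ = ⟪w, S R g⟫ ≤ ‖w‖ ‖S R g‖`, so the previous bound closes on itself and gives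
  `E ⟪S† w, R S† w⟫ ≤ (C² / n) ‖w‖²`. Trivially, also `⟪v, R v⟫ ≤ ‖v‖² / c`.
* Bias (`integral_norm_sq_bias_le`). Splitting the spectral expansion of `f = L_K ^ r h` at the level
  `λ` writes `f = S† w + v` with `‖w‖ ≤ λ ^ (r - 1) ‖h‖` and `‖v‖ ≤ λ ^ (r - 1/2) ‖h‖`
  (`exists_source_decomposition`), and the two bounds give `E ‖S c R f‖² ≤ 4 C⁴ λ ^ (2 r) ‖h‖²`.
* Variance (`integral_sum_norm_sq_sampleRidge_le`). By Parseval's identity in `L²(μ)`, the sum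
  `∑ ‖S R K_{x_i}‖²` is at most `∑ ⟪S† b, R S† b⟫` over a Hilbert basis, and splitting each `b`
  as `L_K u + λ u` with `u = (λ + L_K)⁻¹ b`, the same two bounds give `(2 C² + 2) / n · N(λ)`.

For the distributed estimator (`integral_dkrrError_le`) the biases are averaged by convexity, while
the noise terms of distinct samples are uncorrelated, so that the weights enter squared. Since the
prescribed parameters satisfy `n λ ≥ C₁ log⁴ 2` and `λ ≥ C₁ |D| ^ (-1 / (2 r + s))`, the constant `C`
is uniform and the variance has the stated rate; the bound on the number of machines is what the
bias of the small machines requires (`sum_mul_regParam_rpow_le`).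
-/

namespace DKRR

/-! ### Resolvents of positive operators -/

section Resolvent

variable {E : Type*} [NormedAddCommGroup E] [InnerProductSpace ℝ E]

/-- The operator `(c I + T)⁻¹`; it is a genuine inverse for `T` positive and `c > 0`. -/
noncomputable def ridge (T : E →L[ℝ] E) (c : ℝ) : E →L[ℝ] E :=
  Ring.inverse (c • ContinuousLinearMap.id ℝ E + T)

variable {T : E →L[ℝ] E} {c : ℝ}

theorem isPositive_add_rankOne (hT : T.IsPositive) (k : E) :
    (T + InnerProductSpace.rankOne ℝ k k).IsPositive :=
  hT.add (InnerProductSpace.isPositive_rankOne_self k)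

/-- The unnormalized empirical covariance operator `∑ i ∈ F, v i ⊗ v i`. -/
noncomputable def sampleOp {ι : Type*} (F : Finset ι) (v : ι → E) : E →L[ℝ] E :=
  ∑ i ∈ F, InnerProductSpace.rankOne ℝ (v i) (v i)

variable {ι : Type*} (F : Finset ι) (v : ι → E)

theorem sampleOp_apply (u : E) : sampleOp F v u = ∑ i ∈ F, ⟪v i, u⟫_ℝ • v i := by
  simp [sampleOp]

theorem isPositive_sampleOp : (sampleOp F v).IsPositive := by
  classical
  induction F using Finset.induction_on with
  | empty => simp [sampleOp]
  | insert a s ha ih =>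
    rw [sampleOp, Finset.sum_insert ha]
    exact (InnerProductSpace.isPositive_rankOne_self _).add ih

theorem inner_sampleOp_self (u : E) : ⟪sampleOp F v u, u⟫_ℝ = ∑ i ∈ F, ⟪v i, u⟫_ℝ ^ 2 := by
  rw [sampleOp_apply, sum_inner]
  exact Finset.sum_congr rfl fun i _ => by rw [inner_smul_left, sq]; simp

variable [CompleteSpace E]

theorem isUnit_smul_id_add (hT : T.IsPositive) (hc : 0 < c) :
    IsUnit (c • ContinuousLinearMap.id ℝ E + T) := by
  refine ContinuousLinearMap.isUnit_of_forall_le_norm_inner_map _ (c := ⟨c, hc.le⟩) hc fun x => ?_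
  have h := hT.inner_nonneg_left x
  have e : ⟪(c • ContinuousLinearMap.id ℝ E + T) x, x⟫_ℝ = ‖x‖ ^ 2 * c + ⟪T x, x⟫_ℝ := by
    simp [inner_add_left, inner_smul_left, mul_comm]
  rw [e, Real.norm_eq_abs]
  exact (le_add_of_nonneg_right h).trans (le_abs_self _)

theorem smul_ridge_add (hT : T.IsPositive) (hc : 0 < c) (f : E) :
    c • ridge T c f + T (ridge T c f) = f := by
  have h := Ring.mul_inverse_cancel _ (isUnit_smul_id_add hT hc)
  simpa [ridge] using congrArg (fun B : E →L[ℝ] E => B f) h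

theorem ridge_eq_of_smul_add (hT : T.IsPositive) (hc : 0 < c) {f u : E}
    (h : c • u + T u = f) : ridge T c f = u := by
  have h' := Ring.inverse_mul_cancel _ (isUnit_smul_id_add hT hc)
  have := congrArg (fun B : E →L[ℝ] E => B u) h'
  simpa [ridge, h] using this

theorem inner_ridge_comm (hT : T.IsPositive) (hc : 0 < c) (f g : E) :
    ⟪ridge T c f, g⟫_ℝ = ⟪f, ridge T c g⟫_ℝ := by
  have hs : ∀ x y, ⟪T x, y⟫_ℝ = ⟪x, T y⟫_ℝ := hT.isSymmetric
  conv_lhs => rw [← smul_ridge_add hT hc g]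
  conv_rhs => rw [← smul_ridge_add hT hc f]
  simp only [inner_add_left, inner_add_right, inner_smul_left, inner_smul_right, hs]
  simp

theorem inner_ridge_self (hT : T.IsPositive) (hc : 0 < c) (f : E) :
    ⟪f, ridge T c f⟫_ℝ = c * ‖ridge T c f‖ ^ 2 + ⟪T (ridge T c f), ridge T c f⟫_ℝ := by
  rw [← real_inner_self_eq_norm_sq, ← real_inner_smul_left, ← inner_add_left,
    smul_ridge_add hT hc f]

theorem inner_ridge_nonneg (hT : T.IsPositive) (hc : 0 < c) (f : E) :
    0 ≤ ⟪f, ridge T c f⟫_ℝ := by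
  rw [inner_ridge_self hT hc]
  have := hT.inner_nonneg_left (ridge T c f)
  positivity

theorem norm_ridge_le (hT : T.IsPositive) (hc : 0 < c) (f : E) : ‖ridge T c f‖ ≤ ‖f‖ / c := by
  rw [le_div_iff₀ hc]
  have h1 := inner_ridge_self hT hc f
  have h2 := real_inner_le_norm f (ridge T c f)
  have h3 := hT.inner_nonneg_left (ridge T c f)
  rcases (norm_nonneg (ridge T c f)).eq_or_lt with h | h
  · rw [← h]; simp
  · nlinarith

theorem inner_ridge_le (hT : T.IsPositive) (hc : 0 < c) (f : E) :
    ⟪f, ridge T c f⟫_ℝ ≤ ‖f‖ ^ 2 / c := by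
  refine (real_inner_le_norm _ _).trans ?_
  rw [sq, mul_div_assoc]
  gcongr
  exact norm_ridge_le hT hc f

/-- The quadratic form of `(c I + T)⁻¹` satisfies `q (a + b) ≤ 2 q a + 2 q b`. -/
theorem inner_ridge_add_le (hT : T.IsPositive) (hc : 0 < c) (f g : E) :
    ⟪f + g, ridge T c (f + g)⟫_ℝ ≤ 2 * ⟪f, ridge T c f⟫_ℝ + 2 * ⟪g, ridge T c g⟫_ℝ := by
  have h := inner_ridge_nonneg hT hc (f - g)
  simp only [map_sub, map_add, inner_sub_left, inner_sub_right, inner_add_left,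
    inner_add_right] at h ⊢
  linarith

/-- The Sherman–Morrison formula for a rank-one update of `T`. -/
theorem ridge_sub_ridge_add_rankOne (hT : T.IsPositive) (hc : 0 < c) (k f : E) :
    ridge T c f = ridge (T + InnerProductSpace.rankOne ℝ k k) c f
      + ⟪k, ridge (T + InnerProductSpace.rankOne ℝ k k) c f⟫_ℝ • ridge T c k := by
  refine ridge_eq_of_smul_add hT hc ?_
  have h1 := smul_ridge_add (isPositive_add_rankOne hT k) hc f
  have h2 := smul_ridge_add hT hc k
  set u := ridge (T + InnerProductSpace.rankOne ℝ k k) c f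
  simp only [add_apply, InnerProductSpace.rankOne_apply] at h1
  calc _ = (c • u + T u) + ⟪k, u⟫_ℝ • (c • ridge T c k + T (ridge T c k)) := by
        rw [map_add, map_smul]; module
    _ = f := by rw [h2, ← h1]; abel

/-- The prediction at `k` made without `k` is at most `1 + ‖k‖² / c` times the prediction
made with it. -/
theorem inner_ridge_sq_le (hT : T.IsPositive) (hc : 0 < c) {κ : ℝ} (k f : E)
    (hk : ‖k‖ ^ 2 ≤ κ) :
    ⟪k, ridge T c f⟫_ℝ ^ 2 ≤ (1 + κ / c) ^ 2
      * ⟪k, ridge (T + InnerProductSpace.rankOne ℝ k k) c f⟫_ℝ ^ 2 := by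
  have h0 := inner_ridge_nonneg hT hc k
  have h1 : ⟪k, ridge T c k⟫_ℝ ≤ κ / c := (inner_ridge_le hT hc k).trans (by gcongr)
  rw [ridge_sub_ridge_add_rankOne hT hc k f, inner_add_right, inner_smul_right]
  set u := ⟪k, ridge (T + InnerProductSpace.rankOne ℝ k k) c f⟫_ℝ
  have : (u + u * ⟪k, ridge T c k⟫_ℝ) ^ 2 = (1 + ⟪k, ridge T c k⟫_ℝ) ^ 2 * u ^ 2 := by ring
  rw [this]
  gcongr

theorem inner_ridge_add_rankOne_le (hT : T.IsPositive) (hc : 0 < c) (k f : E) :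
    ⟪f, ridge (T + InnerProductSpace.rankOne ℝ k k) c f⟫_ℝ ≤ ⟪f, ridge T c f⟫_ℝ := by
  have h0 := inner_ridge_nonneg hT hc k
  have e := ridge_sub_ridge_add_rankOne hT hc k f
  set u := ridge (T + InnerProductSpace.rankOne ℝ k k) c f
  have h1 : ⟪f, ridge T c k⟫_ℝ = ⟪k, u⟫_ℝ * (1 + ⟪k, ridge T c k⟫_ℝ) := by
    rw [← inner_ridge_comm hT hc, real_inner_comm, e, inner_add_right, inner_smul_right]
    ring
  rw [e, inner_add_right, inner_smul_right, h1]
  nlinarith [mul_nonneg (sq_nonneg ⟪k, u⟫_ℝ) h0, sq_nonneg ⟪k, u⟫_ℝ]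

theorem continuous_ridge {Y : Type*} [TopologicalSpace Y] {A : Y → E →L[ℝ] E}
    (hA : Continuous A) (hpos : ∀ y, (A y).IsPositive) (hc : 0 < c) :
    Continuous fun y => ridge (A y) c := by
  refine continuous_iff_continuousAt.2 fun y => ?_
  obtain ⟨u, hu⟩ := isUnit_smul_id_add (hpos y) hc
  have h := NormedRing.inverse_continuousAt u
  rw [hu] at h
  exact ContinuousAt.comp (f := fun y => c • ContinuousLinearMap.id ℝ E + A y) h
    (by fun_prop)

theorem sum_inner_ridge_sq_le (hT : T.IsPositive) (hc : 0 < c) (f : E)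
    (hF : ∀ u, ∑ i ∈ F, ⟪v i, u⟫_ℝ ^ 2 ≤ ⟪T u, u⟫_ℝ) :
    ∑ i ∈ F, ⟪v i, ridge T c f⟫_ℝ ^ 2 ≤ ⟪f, ridge T c f⟫_ℝ := by
  rw [inner_ridge_self hT hc]
  have := hF (ridge T c f)
  have : 0 ≤ c * ‖ridge T c f‖ ^ 2 := by positivity
  linarith

end Resolvent

/-! ### Resampling one coordinate of an i.i.d. sample -/

section Resampling

variable {ι : Type*} [DecidableEq ι] {Z : Type*} [MeasurableSpace Z]

theorem measurable_update_prod (i : ι) :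
    Measurable fun p : (ι → Z) × Z => Function.update p.1 i p.2 := by
  refine measurable_pi_lambda _ fun j => ?_
  by_cases h : j = i
  · subst h; simpa using measurable_snd
  · simp only [Function.update_of_ne h]
    exact (measurable_pi_apply j).comp measurable_fst

variable [Fintype ι] (ν : Measure Z) [IsProbabilityMeasure ν]

theorem measurePreserving_update (i : ι) :
    MeasurePreserving (fun p : (ι → Z) × Z => Function.update p.1 i p.2)
      ((Measure.pi fun _ : ι => ν).prod ν) (Measure.pi fun _ : ι => ν) := by
  refine ⟨measurable_update_prod i, (Measure.pi_eq fun s hs => ?_).symm⟩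
  rw [Measure.map_apply (measurable_update_prod i) (MeasurableSet.univ_pi hs)]
  have : (fun p : (ι → Z) × Z => Function.update p.1 i p.2) ⁻¹' Set.pi Set.univ s
      = (Set.pi Set.univ (Function.update s i Set.univ)) ×ˢ s i := by
    ext p
    simp only [Set.mem_preimage, Set.mem_pi, Set.mem_univ, true_imp_iff, Set.mem_prod]
    constructor
    · refine fun h => ⟨fun j => ?_, by simpa using h i⟩
      by_cases hj : j = i
      · subst hj; simp
      · simpa [hj] using h j
    · rintro ⟨h, h'⟩ j
      by_cases hj : j = i
      · subst hj; simpa using h'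
      · simpa [hj] using h j
  rw [this, Measure.prod_prod, Measure.pi_pi,
    ← Finset.mul_prod_erase Finset.univ (fun j => ν (s j)) (Finset.mem_univ i),
    ← Finset.mul_prod_erase Finset.univ _ (Finset.mem_univ i), mul_comm (ν (s i))]
  simp only [Function.update_self, measure_univ, one_mul]
  congr 1
  exact Finset.prod_congr rfl fun j hj => by rw [Function.update_of_ne (Finset.ne_of_mem_erase hj)]

/-- Exchanging a sample point with a fresh one preserves the joint law. -/
theorem measurePreserving_swap_update (i : ι) :
    MeasurePreserving (fun p : (ι → Z) × Z => (Function.update p.1 i p.2, p.1 i))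
      ((Measure.pi fun _ : ι => ν).prod ν) ((Measure.pi fun _ : ι => ν).prod ν) := by
  set P := Measure.pi fun _ : ι => ν
  have hm : Measurable fun p : (ι → Z) × Z => (Function.update p.1 i p.2, p.1 i) :=
    (measurable_update_prod i).prodMk ((measurable_pi_apply i).comp measurable_fst)
  have hU := measurePreserving_update ν i
  -- A triple `(D, z, x)` of a sample and two fresh points; `(update D i z, x)` has law `P ⊗ ν`,
  -- and the map in question sends it to `(update D i x, z)`.
  have h1 : MeasurePreserving
      (fun q : ((ι → Z) × Z) × Z => (Function.update q.1.1 i q.1.2, q.2))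
      ((P.prod ν).prod ν) (P.prod ν) := hU.prod (MeasurePreserving.id ν)
  have h2 : MeasurePreserving (fun q : ((ι → Z) × Z) × Z => ((q.1.1, q.2), q.1.2))
      ((P.prod ν).prod ν) ((P.prod ν).prod ν) := by
    have a := measurePreserving_prodAssoc P ν ν
    have b : MeasurePreserving (Prod.map id Prod.swap) (P.prod (ν.prod ν)) (P.prod (ν.prod ν)) :=
      (MeasurePreserving.id P).prod Measure.measurePreserving_swap
    exact (a.symm.comp b).comp a
  refine ⟨hm, ?_⟩
  conv_lhs => rw [← h1.map_eq]
  rw [Measure.map_map hm h1.measurable]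
  convert! (h1.comp h2).map_eq using 2
  ext q <;> simp

end Resampling

/-! ### Leave-one-out estimates for the empirical resolvent -/

section LeaveOneOut

theorem integrable_of_continuous {Y : Type*} [TopologicalSpace Y] [CompactSpace Y]
    [MeasurableSpace Y] [BorelSpace Y] {P : Measure Y} [IsFiniteMeasure P] {f : Y → ℝ}
    (hf : Continuous f) : Integrable f P :=
  hf.integrable_of_hasCompactSupport (HasCompactSupport.of_compactSpace f)

section Continuity

variable {X ι H : Type*} [NormedAddCommGroup H] [InnerProductSpace ℝ H]

/-- The resolvent `(c I + ∑ i ∈ F, k (D i) ⊗ k (D i))⁻¹` of the empirical covariance operator. -/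
noncomputable def sampleRidge (k : X → H) (F : Finset ι) (c : ℝ) (D : ι → X) : H →L[ℝ] H :=
  ridge (sampleOp F fun i => k (D i)) c

variable [TopologicalSpace X] {k : X → H}

theorem continuous_rankOne_self (hk : Continuous k) :
    Continuous fun x => InnerProductSpace.rankOne ℝ (k x) (k x) :=
  ((InnerProductSpace.rankOne ℝ (E := H) (F := H)).continuous.comp hk).clm_apply hk

theorem continuous_sampleRidge [CompleteSpace H] {F : Finset ι} {c : ℝ} (hk : Continuous k)
    (hc : 0 < c) : Continuous (sampleRidge k F c) := by
  refine continuous_ridge ?_ (fun D => isPositive_sampleOp _ _) hc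
  exact continuous_finsetSum _ fun i _ =>
    continuous_rankOne_self (hk.comp (continuous_apply i))

end Continuity

variable {X : Type*} [MetricSpace X] [CompactSpace X] [MeasurableSpace X] [BorelSpace X]
  {μ : Measure X} [IsProbabilityMeasure μ]
  {H : Type*} [NormedAddCommGroup H] [InnerProductSpace ℝ H] [CompleteSpace H]
  {G : Type*} [NormedAddCommGroup G] [InnerProductSpace ℝ G]
  {k : X → H} {S : H →L[ℝ] G} {κ c : ℝ} {ι : Type*} [Fintype ι] {F : Finset ι}

/-- Leave-one-out bound: the mean squared norm of `S R f` is an average of squared predictions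
`⟪k x, R f⟫` at a fresh point `x`. By `inner_ridge_sq_le`, adding `x` to the sample costs only the
factor `(1 + κ / c) ^ 2`; after that `x` is exchangeable with the sample points, and the sum of
the squared predictions over the sample is at most `⟪f, R f⟫`. -/
theorem integral_norm_sq_sampleRidge_le (hk : Continuous k)
    (hS : ∀ g, ‖S g‖ ^ 2 = ∫ x, ⟪k x, g⟫_ℝ ^ 2 ∂μ) (hκ : ∀ x, ‖k x‖ ^ 2 ≤ κ)
    (hF : F.Nonempty) (hc : 0 < c) (f : H) :
    ∫ D, ‖S (sampleRidge k F c D f)‖ ^ 2 ∂(Measure.pi fun _ : ι => μ)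
      ≤ (1 + κ / c) ^ 2 / F.card
        * ∫ D, ⟪f, sampleRidge k F c D f⟫_ℝ ∂(Measure.pi fun _ : ι => μ) := by
  classical
  set P := Measure.pi fun _ : ι => μ
  have hcR := continuous_sampleRidge (ι := ι) (F := F) hk hc
  -- `R' (D, x)` is the resolvent of the sample `D` enlarged by the fresh point `x`
  set R' : (ι → X) × X → H →L[ℝ] H := fun p =>
    ridge (sampleOp F (fun i => k (p.1 i)) + InnerProductSpace.rankOne ℝ (k p.2) (k p.2)) c
  have hpos : ∀ p : (ι → X) × X, (sampleOp F (fun i => k (p.1 i))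
      + InnerProductSpace.rankOne ℝ (k p.2) (k p.2)).IsPositive := fun p =>
    isPositive_add_rankOne (isPositive_sampleOp _ _) _
  have hcR' : Continuous R' := by
    refine continuous_ridge ?_ hpos hc
    refine .add (continuous_finsetSum _ fun i _ => continuous_rankOne_self
      (hk.comp ((continuous_apply i).comp continuous_fst)))
      (continuous_rankOne_self (hk.comp continuous_snd))
  have hcard : (0 : ℝ) < F.card := by exact_mod_cast hF.card_pos
  -- the fresh point and the sample points are exchangeable for `R'`
  have hexch : ∀ i ∈ F, ∫ p, ⟪k p.2, R' p f⟫_ℝ ^ 2 ∂(P.prod μ)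
      = ∫ p, ⟪k (p.1 i), R' p f⟫_ℝ ^ 2 ∂(P.prod μ) := by
    intro i hi
    have hT := measurePreserving_swap_update μ i
    have hcont : Continuous fun p : (ι → X) × X => ⟪k p.2, R' p f⟫_ℝ ^ 2 := by fun_prop
    rw [← hT.map_eq, integral_map hT.measurable.aemeasurable hcont.aestronglyMeasurable, hT.map_eq]
    congr 1
    ext p
    have : R' (Function.update p.1 i p.2, p.1 i) = R' p := by
      simp only [R', sampleOp]
      congr 1
      rw [← Finset.add_sum_erase F _ hi, ← Finset.add_sum_erase F (fun j =>
        InnerProductSpace.rankOne ℝ (k (p.1 j)) (k (p.1 j))) hi, Function.update_self]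
      rw [Finset.sum_congr rfl fun j hj => by
        rw [Function.update_of_ne (Finset.ne_of_mem_erase hj)]]
      abel
    rw [this]
  have hsum : F.card * ∫ p, ⟪k p.2, R' p f⟫_ℝ ^ 2 ∂(P.prod μ)
      ≤ ∫ D, ⟪f, sampleRidge k F c D f⟫_ℝ ∂P := by
    calc F.card * ∫ p, ⟪k p.2, R' p f⟫_ℝ ^ 2 ∂(P.prod μ)
        = ∑ i ∈ F, ∫ p, ⟪k (p.1 i), R' p f⟫_ℝ ^ 2 ∂(P.prod μ) := by
          rw [← Finset.sum_congr rfl hexch, Finset.sum_const, nsmul_eq_mul]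
      _ = ∫ p, ∑ i ∈ F, ⟪k (p.1 i), R' p f⟫_ℝ ^ 2 ∂(P.prod μ) := by
          rw [integral_finsetSum]
          exact fun i _ => integrable_of_continuous (by fun_prop)
      _ ≤ ∫ p, ⟪f, sampleRidge k F c p.1 f⟫_ℝ ∂(P.prod μ) := by
          refine integral_mono (integrable_of_continuous (by fun_prop))
            (integrable_of_continuous (by fun_prop)) fun p => ?_
          refine (sum_inner_ridge_sq_le F _ (hpos p) hc f fun u => ?_).trans
            (inner_ridge_add_rankOne_le (isPositive_sampleOp _ _) hc _ _)
          rw [add_apply, inner_add_left, inner_sampleOp_self]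
          exact le_add_of_nonneg_right
            ((InnerProductSpace.isPositive_rankOne_self (k p.2)).inner_nonneg_left u)
      _ = ∫ D, ⟪f, sampleRidge k F c D f⟫_ℝ ∂P := by
          rw [integral_prod _ (integrable_of_continuous (by fun_prop))]
          simp
  calc ∫ D, ‖S (sampleRidge k F c D f)‖ ^ 2 ∂P
      = ∫ p, ⟪k p.2, sampleRidge k F c p.1 f⟫_ℝ ^ 2 ∂(P.prod μ) := by
        rw [integral_prod _ (integrable_of_continuous (by fun_prop))]
        simp_rw [hS]
    _ ≤ ∫ p, (1 + κ / c) ^ 2 * ⟪k p.2, R' p f⟫_ℝ ^ 2 ∂(P.prod μ) :=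
        integral_mono (integrable_of_continuous (by fun_prop))
          (integrable_of_continuous (by fun_prop)) fun p =>
          inner_ridge_sq_le (isPositive_sampleOp _ _) hc _ _ (hκ _)
    _ ≤ _ := by
        rw [integral_const_mul, div_mul_eq_mul_div, mul_div_assoc]
        gcongr
        rwa [le_div_iff₀ hcard, mul_comm]

variable [CompleteSpace G]

/-- Self-bounding step: `⟪S† w, R S† w⟫ = ⟪w, S R S† w⟫` is controlled by `‖w‖` and by
`‖S R S† w‖`, whose second moment is bounded by the mean of the left-hand side again. -/
theorem integral_inner_sampleRidge_adjoint_le (hk : Continuous k)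
    (hS : ∀ g, ‖S g‖ ^ 2 = ∫ x, ⟪k x, g⟫_ℝ ^ 2 ∂μ) (hκ : ∀ x, ‖k x‖ ^ 2 ≤ κ)
    (hF : F.Nonempty) (hc : 0 < c) (hκ0 : 0 ≤ κ) (w : G) :
    ∫ D, ⟪S.adjoint w, sampleRidge k F c D (S.adjoint w)⟫_ℝ ∂(Measure.pi fun _ : ι => μ)
      ≤ (1 + κ / c) ^ 2 / F.card * ‖w‖ ^ 2 := by
  set P := Measure.pi fun _ : ι => μ
  have hcR := continuous_sampleRidge (ι := ι) (F := F) hk hc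
  have hcard : (0 : ℝ) < F.card := by exact_mod_cast hF.card_pos
  have hC : 0 < 1 + κ / c := by positivity
  set t := (1 + κ / c) ^ 2 / (F.card : ℝ)
  have ht : 0 < t := by positivity
  set a := ∫ D, ⟪S.adjoint w, sampleRidge k F c D (S.adjoint w)⟫_ℝ ∂P
  have hkey := integral_norm_sq_sampleRidge_le (ι := ι) hk hS hκ hF hc (S.adjoint w)
  have h1 : a ≤ ∫ D, (t / 2 * ‖w‖ ^ 2
      + 1 / (2 * t) * ‖S (sampleRidge k F c D (S.adjoint w))‖ ^ 2) ∂P := by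
    refine integral_mono (integrable_of_continuous (by fun_prop))
      (integrable_of_continuous (by fun_prop)) fun D => ?_
    simp only [ContinuousLinearMap.adjoint_inner_left]
    refine (real_inner_le_norm _ _).trans ?_
    set y := ‖S (sampleRidge k F c D (S.adjoint w))‖
    have : t / 2 * ‖w‖ ^ 2 + 1 / (2 * t) * y ^ 2 - ‖w‖ * y = (t * ‖w‖ - y) ^ 2 / (2 * t) := by
      field_simp; ring
    have h2 : 0 ≤ (t * ‖w‖ - y) ^ 2 / (2 * t) := by positivity
    linarith
  rw [integral_add (integrable_of_continuous (by fun_prop))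
    (integrable_of_continuous (by fun_prop)), integral_const_mul (1 / (2 * t))] at h1
  have h2 : 1 / (2 * t) * ∫ D, ‖S (sampleRidge k F c D (S.adjoint w))‖ ^ 2 ∂P ≤ a / 2 :=
    calc _ ≤ 1 / (2 * t) * (t * a) := by gcongr
      _ = a / 2 := by field_simp
  simp only [integral_const, probReal_univ, one_smul] at h1
  linarith

/-- Combination of the two bounds on the mean resolvent: on the range of `S†`, and in norm. -/
theorem integral_inner_sampleRidge_le (hk : Continuous k)
    (hS : ∀ g, ‖S g‖ ^ 2 = ∫ x, ⟪k x, g⟫_ℝ ^ 2 ∂μ) (hκ : ∀ x, ‖k x‖ ^ 2 ≤ κ)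
    (hF : F.Nonempty) (hc : 0 < c) (hκ0 : 0 ≤ κ) (w : G) (v : H) :
    ∫ D, ⟪S.adjoint w + v, sampleRidge k F c D (S.adjoint w + v)⟫_ℝ
        ∂(Measure.pi fun _ : ι => μ)
      ≤ 2 * ((1 + κ / c) ^ 2 / F.card * ‖w‖ ^ 2) + 2 * (‖v‖ ^ 2 / c) := by
  have hcR := continuous_sampleRidge (ι := ι) (F := F) hk hc
  calc _ ≤ ∫ D, (2 * ⟪S.adjoint w, sampleRidge k F c D (S.adjoint w)⟫_ℝ + 2 * (‖v‖ ^ 2 / c))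
        ∂(Measure.pi fun _ : ι => μ) := by
        refine integral_mono (integrable_of_continuous (by fun_prop))
          (integrable_of_continuous (by fun_prop)) fun D => ?_
        refine (inner_ridge_add_le (isPositive_sampleOp _ _) hc _ _).trans ?_
        have := inner_ridge_le (isPositive_sampleOp F fun i => k (D i)) hc v
        simp only [sampleRidge]
        linarith
    _ = 2 * ∫ D, ⟪S.adjoint w, sampleRidge k F c D (S.adjoint w)⟫_ℝ
          ∂(Measure.pi fun _ : ι => μ) + 2 * (‖v‖ ^ 2 / c) := by
        rw [integral_add (integrable_of_continuous (by fun_prop))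
          (integrable_of_continuous (by fun_prop)), integral_const_mul]
        simp
    _ ≤ _ := by
        gcongr
        exact integral_inner_sampleRidge_adjoint_le hk hS hκ hF hc hκ0 w

end LeaveOneOut

/-! ### The variance and the effective dimension -/

section Variance

theorem countable_of_orthonormal {E : Type*} [NormedAddCommGroup E] [InnerProductSpace ℝ E]
    [SecondCountableTopology E] {ι : Type*} {b : ι → E} (hb : Orthonormal ℝ b) : Countable ι := by
  have hd : Pairwise (Function.onFun Disjoint fun i => Metric.ball (b i) (1 / 2)) := by
    intro i j hij
    refine Metric.ball_disjoint_ball ?_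
    rw [dist_eq_norm]
    have h : ‖b i - b j‖ ^ 2 = 2 := by
      rw [norm_sub_sq_real, hb.1, hb.1, hb.2 hij]; norm_num
    nlinarith [norm_nonneg (b i - b j)]
  exact hd.countable_of_isOpen_disjoint (fun i => Metric.isOpen_ball)
    fun i => ⟨b i, Metric.mem_ball_self (by norm_num)⟩

section Commute

variable {E : Type*} [NormedAddCommGroup E] [InnerProductSpace ℝ E] [CompleteSpace E]
  {T : E →L[ℝ] E} {c : ℝ}

theorem ridge_map (hT : T.IsPositive) (hc : 0 < c) (f : E) :
    ridge T c (T f) = T (ridge T c f) := by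
  refine ridge_eq_of_smul_add hT hc ?_
  rw [← map_smul, ← map_add, smul_ridge_add hT hc]

theorem inner_ridge_map_self (hT : T.IsPositive) (hc : 0 < c) (f : E) :
    ⟪f, ridge T c (T f)⟫_ℝ
      = ‖T (ridge T c f)‖ ^ 2 + c * ⟪ridge T c f, T (ridge T c f)⟫_ℝ := by
  rw [ridge_map hT hc]
  nth_rw 1 [← smul_ridge_add hT hc f]
  rw [inner_add_left, inner_smul_left, real_inner_self_eq_norm_sq, add_comm]
  simp

theorem isPositive_ridge_mul (hT : T.IsPositive) (hc : 0 < c) : (ridge T c * T).IsPositive := by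
  refine (ContinuousLinearMap.isPositive_iff _).2 ⟨fun x y => ?_, fun x => ?_⟩
  · have hs : ∀ x y, ⟪T x, y⟫_ℝ = ⟪x, T y⟫_ℝ := hT.isSymmetric
    change ⟪ridge T c (T x), y⟫_ℝ = ⟪x, ridge T c (T y)⟫_ℝ
    rw [inner_ridge_comm hT hc, hs, ridge_map hT hc]
  · change 0 ≤ ⟪ridge T c (T x), x⟫_ℝ
    rw [real_inner_comm, inner_ridge_map_self hT hc]
    have := hT.inner_nonneg_right (ridge T c x)
    positivity

end Commute

variable {X : Type*} [MetricSpace X] [CompactSpace X] [MeasurableSpace X] [BorelSpace X]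
  {μ : Measure X} [IsProbabilityMeasure μ]
  {H : Type*} [NormedAddCommGroup H] [InnerProductSpace ℝ H] [CompleteSpace H]
  {G : Type*} [NormedAddCommGroup G] [InnerProductSpace ℝ G] [CompleteSpace G]
  {k : X → H} {S : H →L[ℝ] G} {κ lam : ℝ} {ι : Type*} [Fintype ι] {F : Finset ι}

/-- With `u = (λ I + S S†)⁻¹ b`, the vector `S† b` is the sum of `S† (S S† u)`, where the bound on
the range of `S†` is efficient, and of `λ S† u`, where the bound in norm is. -/
theorem integral_inner_sampleRidge_adjoint_le_ridge (hk : Continuous k)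
    (hS : ∀ g, ‖S g‖ ^ 2 = ∫ x, ⟪k x, g⟫_ℝ ^ 2 ∂μ) (hκ : ∀ x, ‖k x‖ ^ 2 ≤ κ) (hκ0 : 0 ≤ κ)
    (hF : F.Nonempty) (hlam : 0 < lam) (b : G) :
    ∫ D, ⟪S.adjoint b, sampleRidge k F (F.card * lam) D (S.adjoint b)⟫_ℝ
        ∂(Measure.pi fun _ : ι => μ)
      ≤ (2 * (1 + κ / (F.card * lam)) ^ 2 + 2) / F.card
        * ⟪b, ridge (S ∘L S.adjoint) lam ((S ∘L S.adjoint) b)⟫_ℝ := by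
  have hcard : (0 : ℝ) < F.card := by exact_mod_cast hF.card_pos
  have hL : (S ∘L S.adjoint).IsPositive := ContinuousLinearMap.isPositive_self_comp_adjoint S
  set L := S ∘L S.adjoint
  set u := ridge L lam b
  have hb : S.adjoint b = S.adjoint (L u) + lam • S.adjoint u := by
    rw [← map_smul, ← map_add, add_comm, smul_ridge_add hL hlam]
  have h := integral_inner_sampleRidge_le (ι := ι) hk hS hκ hF (mul_pos hcard hlam) hκ0 (L u)
    (lam • S.adjoint u)
  have hn : ‖lam • S.adjoint u‖ ^ 2 = lam ^ 2 * ⟪u, L u⟫_ℝ := by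
    rw [norm_smul, mul_pow, Real.norm_eq_abs, sq_abs, ← real_inner_self_eq_norm_sq,
      ContinuousLinearMap.adjoint_inner_left]
    rfl
  rw [← hb, hn] at h
  rw [inner_ridge_map_self hL hlam]
  refine h.trans ?_
  have h0 : 0 ≤ ⟪u, L u⟫_ℝ := hL.inner_nonneg_right u
  set C := 1 + κ / (F.card * lam)
  calc 2 * (C ^ 2 / F.card * ‖L u‖ ^ 2) + 2 * (lam ^ 2 * ⟪u, L u⟫_ℝ / (F.card * lam))
      = 2 * C ^ 2 / F.card * ‖L u‖ ^ 2 + 2 / F.card * (lam * ⟪u, L u⟫_ℝ) := by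
        field_simp
    _ ≤ (2 * C ^ 2 + 2) / F.card * ‖L u‖ ^ 2
          + (2 * C ^ 2 + 2) / F.card * (lam * ⟪u, L u⟫_ℝ) := by
        gcongr
        · linarith
        · linarith [sq_nonneg C]
    _ = _ := by ring

/-- The variance bound. By Parseval's identity in `G`, the sum of the `‖S R k (D i)‖ ^ 2` is the sum
over a Hilbert basis `b` of `∑ i ∈ F, ⟪k (D i), R S† b⟫ ^ 2 ≤ ⟪S† b, R S† b⟫`, and the bounds on the
mean of the latter add up to the trace in the effective dimension. -/
theorem integral_sum_norm_sq_sampleRidge_le [SecondCountableTopology G] (hk : Continuous k)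
    (hS : ∀ g, ‖S g‖ ^ 2 = ∫ x, ⟪k x, g⟫_ℝ ^ 2 ∂μ) (hκ : ∀ x, ‖k x‖ ^ 2 ≤ κ) (hκ0 : 0 ≤ κ)
    (hF : F.Nonempty) (hlam : 0 < lam) {d : ℝ} (hd0 : 0 ≤ d)
    (hd : effectiveDimension (S ∘L S.adjoint) lam ≤ ENNReal.ofReal d) :
    ∫ D, ∑ i ∈ F, ‖S (sampleRidge k F (F.card * lam) D (k (D i)))‖ ^ 2
        ∂(Measure.pi fun _ : ι => μ)
      ≤ (2 * (1 + κ / (F.card * lam)) ^ 2 + 2) / F.card * d := by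
  have hcard : (0 : ℝ) < F.card := by exact_mod_cast hF.card_pos
  have hL : (S ∘L S.adjoint).IsPositive := ContinuousLinearMap.isPositive_self_comp_adjoint S
  have hc : 0 < F.card * lam := mul_pos hcard hlam
  set P := Measure.pi fun _ : ι => μ
  have hcR := continuous_sampleRidge (ι := ι) (F := F) hk hc
  set R := sampleRidge k F (F.card * lam)
  set A := (2 * (1 + κ / (F.card * lam)) ^ 2 + 2) / (F.card : ℝ)
  have hA : 0 ≤ A := by positivity
  obtain ⟨w, b, -⟩ := exists_hilbertBasis ℝ G
  have : Countable w := countable_of_orthonormal b.orthonormal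
  have hcont : ∀ β, Continuous fun D => ∑ i ∈ F, ⟪b β, S (R D (k (D i)))⟫_ℝ ^ 2 := by
    intro β; fun_prop
  have hpars : ∀ D, ENNReal.ofReal (∑ i ∈ F, ‖S (R D (k (D i)))‖ ^ 2)
      = ∑' β, ENNReal.ofReal (∑ i ∈ F, ⟪b β, S (R D (k (D i)))⟫_ℝ ^ 2) := by
    intro D
    have h : HasSum (fun β => ∑ i ∈ F, ⟪b β, S (R D (k (D i)))⟫_ℝ ^ 2)
        (∑ i ∈ F, ‖S (R D (k (D i)))‖ ^ 2) := by
      refine hasSum_sum fun i _ => ?_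
      have h := b.hasSum_inner_mul_inner (S (R D (k (D i)))) (S (R D (k (D i))))
      rw [real_inner_self_eq_norm_sq] at h
      convert! h using 2 with β
      rw [real_inner_comm, sq]
    rw [← h.tsum_eq, ENNReal.ofReal_tsum_of_nonneg (fun β => by positivity) h.summable]
  have hβ : ∀ β, ∫⁻ D, ENNReal.ofReal (∑ i ∈ F, ⟪b β, S (R D (k (D i)))⟫_ℝ ^ 2) ∂P
      ≤ ENNReal.ofReal A
        * ENNReal.ofReal ⟪b β, (ridge (S ∘L S.adjoint) lam * (S ∘L S.adjoint)) (b β)⟫_ℝ := by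
    intro β
    rw [← ofReal_integral_eq_lintegral_ofReal (integrable_of_continuous (hcont β))
      (.of_forall fun D => by positivity), ← ENNReal.ofReal_mul hA]
    refine ENNReal.ofReal_le_ofReal (le_trans ?_
      (integral_inner_sampleRidge_adjoint_le_ridge (ι := ι) hk hS hκ hκ0 hF hlam (b β)))
    refine integral_mono (integrable_of_continuous (hcont β))
      (integrable_of_continuous ?_) fun D => ?_
    · exact continuous_const.inner (hcR.clm_apply continuous_const)
    have hT := isPositive_sampleOp F fun i => k (D i)
    refine le_trans (le_of_eq (Finset.sum_congr rfl fun i _ => ?_))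
      (sum_inner_ridge_sq_le F (fun i => k (D i)) hT hc (S.adjoint (b β))
        fun u => (inner_sampleOp_self F _ u).ge)
    rw [← ContinuousLinearMap.adjoint_inner_left]
    exact congrArg (· ^ 2) ((inner_ridge_comm hT hc _ _).symm.trans (real_inner_comm _ _))
  have hfin : ENNReal.ofReal (∫ D, ∑ i ∈ F, ‖S (R D (k (D i)))‖ ^ 2 ∂P)
      ≤ ENNReal.ofReal (A * d) := by
    rw [ofReal_integral_eq_lintegral_ofReal (integrable_of_continuous (by fun_prop))
      (.of_forall fun D => by positivity)]
    simp_rw [hpars]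
    rw [lintegral_tsum fun β => (hcont β).measurable.ennreal_ofReal.aemeasurable]
    refine (ENNReal.tsum_le_tsum hβ).trans ?_
    rw [ENNReal.tsum_mul_left, ENNReal.ofReal_mul hA,
      ← positiveTrace_eq_tsum (isPositive_ridge_mul hL hlam)]
    gcongr
    exact hd
  exact (ENNReal.ofReal_le_ofReal_iff (by positivity)).1 hfin

end Variance

/-! ### The source condition -/

section Source

theorem summable_of_orthogonal {E : Type*} [NormedAddCommGroup E] [InnerProductSpace ℝ E]
    [CompleteSpace E] {ι : Type*} {x : ι → E} (hx : Pairwise fun i j => ⟪x i, x j⟫_ℝ = 0)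
    {B : ℝ} (hB0 : 0 ≤ B) (hB : ∀ s : Finset ι, ∑ i ∈ s, ‖x i‖ ^ 2 ≤ B ^ 2) :
    Summable x ∧ ‖∑' i, x i‖ ≤ B := by
  have hV : OrthogonalFamily ℝ (fun i => (ℝ ∙ x i : Submodule ℝ E))
      fun i => (ℝ ∙ x i : Submodule ℝ E).subtypeₗᵢ := by
    refine OrthogonalFamily.of_pairwise fun i j hij => ?_
    exact (Submodule.isOrtho_span (𝕜 := ℝ)).2 fun u hu v hv => by
      rw [Set.mem_singleton_iff.1 hu, Set.mem_singleton_iff.1 hv]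
      exact hx hij
  set l : ∀ i, (ℝ ∙ x i : Submodule ℝ E) := fun i => ⟨x i, Submodule.mem_span_singleton_self _⟩
  have hs : Summable x := by
    refine (hV.summable_iff_norm_sq_summable l).2 ?_
    exact summable_of_sum_le (fun i => by positivity) hB
  refine ⟨hs, le_of_tendsto' hs.hasSum.norm fun s => ?_⟩
  refine le_of_sq_le_sq ?_ hB0
  exact (hV.norm_sum l s).trans_le (hB s)

variable {H : Type*} [NormedAddCommGroup H] [InnerProductSpace ℝ H] [CompleteSpace H]
  {G : Type*} [NormedAddCommGroup G] [InnerProductSpace ℝ G] [CompleteSpace G]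

/-- The eigenprojection of `h` on `ker (T - t)`, the summand of `opPower`. -/
noncomputable def eigenProj (T : G →L[ℝ] G) (h : G) (t : ℝ) : G :=
  ((T - t • ContinuousLinearMap.id ℝ G).ker).starProjection h

theorem map_eigenProj (T : G →L[ℝ] G) (h : G) (t : ℝ) :
    T (eigenProj T h t) = t • eigenProj T h t := by
  have hm : eigenProj T h t ∈ (T - t • ContinuousLinearMap.id ℝ G).ker :=
    Submodule.starProjection_apply_mem _ _
  have := LinearMap.mem_ker.1 hm
  simpa [sub_eq_zero] using this

theorem inner_eigenProj {T : G →L[ℝ] G} (hT : T.IsPositive) (h : G) {t t' : ℝ} (ht : t ≠ t') :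
    ⟪eigenProj T h t, eigenProj T h t'⟫_ℝ = 0 := by
  have hs : ∀ x y, ⟪T x, y⟫_ℝ = ⟪x, T y⟫_ℝ := hT.isSymmetric
  have e := hs (eigenProj T h t) (eigenProj T h t')
  rw [map_eigenProj, map_eigenProj, inner_smul_left, inner_smul_right] at e
  simp only [conj_trivial] at e
  have : (t - t') * ⟪eigenProj T h t, eigenProj T h t'⟫_ℝ = 0 := by linarith
  exact (mul_eq_zero.1 this).resolve_left (sub_ne_zero.2 ht)

theorem eigenProj_bounds {T : G →L[ℝ] G} (hT : T.IsPositive) {h : G} {t : ℝ}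
    (ht : eigenProj T h t ≠ 0) : 0 ≤ t ∧ t ≤ ‖T‖ := by
  have hn : 0 < ‖eigenProj T h t‖ := norm_pos_iff.2 ht
  constructor
  · have := hT.inner_nonneg_left (eigenProj T h t)
    rw [map_eigenProj, inner_smul_left, real_inner_self_eq_norm_sq] at this
    simp only [conj_trivial] at this
    exact nonneg_of_mul_nonneg_left this (by positivity)
  · have := T.le_opNorm (eigenProj T h t)
    rw [map_eigenProj, norm_smul] at this
    exact (le_abs_self t).trans (le_of_mul_le_mul_right this hn)

theorem sum_norm_eigenProj_le {T : G →L[ℝ] G} (hT : T.IsPositive) (h : G) (s : Finset ℝ) :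
    ∑ t ∈ s, ‖eigenProj T h t‖ ^ 2 ≤ ‖h‖ ^ 2 := by
  have h1 : ∀ t, ⟪h, eigenProj T h t⟫_ℝ = ‖eigenProj T h t‖ ^ 2 := by
    intro t
    rw [← real_inner_self_eq_norm_sq]
    unfold eigenProj
    rw [Submodule.inner_starProjection_left_eq_right, Submodule.starProjection_eq_self_iff.2
      (Submodule.starProjection_apply_mem _ _)]
  have h2 : ‖∑ t ∈ s, eigenProj T h t‖ ^ 2 = ∑ t ∈ s, ‖eigenProj T h t‖ ^ 2 := by
    rw [← real_inner_self_eq_norm_sq, sum_inner]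
    refine Finset.sum_congr rfl fun t ht => ?_
    rw [inner_sum, Finset.sum_eq_single t, real_inner_self_eq_norm_sq]
    · exact fun t' _ hne => inner_eigenProj hT h hne.symm
    · exact fun hn => (hn ht).elim
  have h3 : ⟪h, ∑ t ∈ s, eigenProj T h t⟫_ℝ = ∑ t ∈ s, ‖eigenProj T h t‖ ^ 2 := by
    rw [inner_sum]; exact Finset.sum_congr rfl fun t _ => h1 t
  have h4 := real_inner_le_norm h (∑ t ∈ s, eigenProj T h t)
  rw [h3, ← h2] at h4
  rw [← h2]
  nlinarith [norm_nonneg h, norm_nonneg (∑ t ∈ s, eigenProj T h t),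
    sq_nonneg (‖h‖ - ‖∑ t ∈ s, eigenProj T h t‖)]

/-- A function `(S S†) ^ r h` with `1/2 ≤ r ≤ 1` has a representative `f` in `H`, and for every
`λ > 0` the part of its spectral expansion above `λ` is `S† w` for a small `w`, while the part
below `λ` is small in `H`. -/
theorem exists_source_decomposition (S : H →L[ℝ] G) {r : ℝ} (hr : 1 / 2 ≤ r) (hr' : r ≤ 1)
    (h : G) :
    ∃ f : H, S f = opPower (S ∘L S.adjoint) r h ∧ ∀ lam : ℝ, 0 < lam → ∃ (w : G) (v : H),
      f = S.adjoint w + v ∧ ‖w‖ ≤ lam ^ (r - 1) * ‖h‖ ∧ ‖v‖ ≤ lam ^ (r - 1 / 2) * ‖h‖ := by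
  have hL : (S ∘L S.adjoint).IsPositive := ContinuousLinearMap.isPositive_self_comp_adjoint S
  set L := S ∘L S.adjoint
  set p : ℝ → G := eigenProj L h
  set u : ℝ → H := fun t => t ^ (r - 1) • S.adjoint (p t)
  have hinner : ∀ x y, ⟪S.adjoint x, S.adjoint y⟫_ℝ = ⟪x, L y⟫_ℝ := fun x y =>
    ContinuousLinearMap.adjoint_inner_left S _ _
  have hu_orth : Pairwise fun t t' => ⟪u t, u t'⟫_ℝ = 0 := by
    intro t t' htt
    simp only [u]
    rw [inner_smul_left, inner_smul_right, hinner, map_eigenProj, inner_smul_right,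
      inner_eigenProj hL h htt]
    simp
  have hu_norm : ∀ t B, 0 ≤ B → t ≤ B → ‖u t‖ ^ 2 ≤ (B ^ (r - 1 / 2)) ^ 2 * ‖p t‖ ^ 2 := by
    intro t B hB htB
    by_cases hp : p t = 0
    · simp [u, hp]
    obtain ⟨ht0, -⟩ := eigenProj_bounds hL hp
    have e : ‖u t‖ ^ 2 = (t ^ (r - 1)) ^ 2 * t * ‖p t‖ ^ 2 := by
      simp only [u]
      rw [norm_smul, mul_pow, ← real_inner_self_eq_norm_sq (S.adjoint (p t)), hinner,
        map_eigenProj, inner_smul_right, real_inner_self_eq_norm_sq, Real.norm_eq_abs, sq_abs]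
      ring
    rw [e]
    gcongr
    rcases ht0.eq_or_lt with h0 | h0
    · rw [← h0, mul_zero]; positivity
    · have : (t ^ (r - 1)) ^ 2 * t = (t ^ (r - 1 / 2)) ^ 2 := by
        rw [← Real.rpow_natCast, ← Real.rpow_natCast, ← Real.rpow_mul ht0, ← Real.rpow_mul ht0]
        nth_rw 2 [← Real.rpow_one t]
        rw [← Real.rpow_add h0]
        congr 1
        push_cast
        ring
      rw [this]
      gcongr
  -- partial sums of any family dominated by the eigenprojections of `h`
  have hdom : ∀ (x : ℝ → ℝ) (B : ℝ), (∀ t, x t ^ 2 ≤ B ^ 2 * ‖p t‖ ^ 2) →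
      ∀ s : Finset ℝ, ∑ t ∈ s, x t ^ 2 ≤ (B * ‖h‖) ^ 2 := by
    intro x B hx s
    calc ∑ t ∈ s, x t ^ 2 ≤ ∑ t ∈ s, B ^ 2 * ‖p t‖ ^ 2 := Finset.sum_le_sum fun t _ => hx t
      _ = B ^ 2 * ∑ t ∈ s, ‖p t‖ ^ 2 := by rw [Finset.mul_sum]
      _ ≤ _ := by
        rw [mul_pow]; gcongr
        exact sum_norm_eigenProj_le hL h s
  have hu_sum : Summable u := by
    refine (summable_of_orthogonal hu_orth (by positivity) (hdom (fun t => ‖u t‖)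
      (‖L‖ ^ (r - 1 / 2)) fun t => ?_)).1
    by_cases hp : p t = 0
    · simp [u, hp]
    · exact hu_norm t _ (norm_nonneg _) (eigenProj_bounds hL hp).2
  refine ⟨∑' t, u t, ?_, fun lam hlam => ?_⟩
  · rw [S.map_tsum hu_sum]
    refine tsum_congr fun t => ?_
    change S (u t) = t ^ r • p t
    by_cases hp : p t = 0
    · simp [u, hp]
    have e : S (u t) = (t ^ (r - 1) * t) • p t := by
      simp only [u]
      rw [map_smul, mul_smul, ← map_eigenProj]
      rfl
    rw [e]
    congr 1
    rcases (eigenProj_bounds hL hp).1.eq_or_lt with h0 | h0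
    · rw [← h0, mul_zero, Real.zero_rpow (by linarith)]
    · rw [← Real.rpow_add_one h0.ne', sub_add_cancel]
  · set x : ℝ → G := fun t => if lam ≤ t then t ^ (r - 1) • p t else 0
    set y : ℝ → H := fun t => if lam ≤ t then 0 else u t
    have hx := summable_of_orthogonal (x := x) (B := lam ^ (r - 1) * ‖h‖) (fun t t' htt => by
        simp only [x]
        split_ifs
        · rw [inner_smul_left, inner_smul_right, inner_eigenProj hL h htt]; simp
        all_goals simp) (by positivity) (hdom (fun t => ‖x t‖) _ fun t => by
        simp only [x]
        split_ifs with hlt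
        · have ht : 0 < t := hlam.trans_le hlt
          rw [norm_smul, mul_pow, Real.norm_eq_abs, sq_abs]
          gcongr ?_ ^ 2 * _
          exact Real.rpow_le_rpow_of_nonpos hlam hlt (by linarith)
        · simp; positivity)
    have hy := summable_of_orthogonal (x := y) (B := lam ^ (r - 1 / 2) * ‖h‖) (fun t t' htt => by
        by_cases h1 : lam ≤ t
        · simp [y, h1]
        by_cases h2 : lam ≤ t'
        · simp [y, h2]
        simp only [y, if_neg h1, if_neg h2]
        exact hu_orth htt) (by positivity) (hdom (fun t => ‖y t‖) _ fun t => by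
        simp only [y]
        split_ifs with hlt
        · simp; positivity
        · exact hu_norm t lam hlam.le (not_le.1 hlt).le)
    refine ⟨∑' t, x t, ∑' t, y t, ?_, hx.2, hy.2⟩
    rw [S.adjoint.map_tsum hx.1, ← (hx.1.mapL S.adjoint).tsum_add hy.1]
    refine tsum_congr fun t => ?_
    simp only [x, y]
    split_ifs
    · simp [u]
    · simp

end Source

/-! ### The reproducing kernel Hilbert space inside `L²` -/

section Inclusion

variable {X : Type*} (H : Type*) [NormedAddCommGroup H] [InnerProductSpace ℝ H] [CompleteSpace H]
  [RKHS ℝ H X ℝ]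

/-- The feature map `x ↦ K(·, x)`. -/
noncomputable def feature (x : X) : H := RKHS.kerFun H x (1 : ℝ)

variable {H} in
theorem inner_feature (x : X) (f : H) : ⟪feature H x, f⟫_ℝ = f x := by
  simp [feature]

variable [MetricSpace X] {K : C(X × X, ℝ)}
  (hH : ∀ x y : X, RKHS.kernel H x y 1 = K (x, y))
include hH

theorem inner_feature_feature (x y : X) : ⟪feature H x, feature H y⟫_ℝ = K (x, y) := by
  rw [inner_feature, feature, RKHS.kerFun_apply, hH]

theorem kernel_symm (x y : X) : K (x, y) = K (y, x) := by
  rw [← inner_feature_feature H hH, ← inner_feature_feature H hH, real_inner_comm]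

theorem continuous_feature : Continuous (feature H : X → H) := by
  refine continuous_iff_continuousAt.2 fun x => ?_
  refine tendsto_iff_norm_sub_tendsto_zero.2 ?_
  have h : ∀ y, ‖feature H y - feature H x‖ = √(K (y, y) - 2 * K (y, x) + K (x, x)) := by
    intro y
    rw [← inner_feature_feature H hH, ← inner_feature_feature H hH, ← inner_feature_feature H hH,
      real_inner_self_eq_norm_sq, real_inner_self_eq_norm_sq, ← norm_sub_sq_real,
      Real.sqrt_sq (norm_nonneg _)]
  simp_rw [h]
  have hc : Continuous fun y => √(K (y, y) - 2 * K (y, x) + K (x, x)) := by fun_prop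
  convert! hc.tendsto x using 2
  rw [show K (x, x) - 2 * K (x, x) + K (x, x) = 0 by ring, Real.sqrt_zero]

omit hH in
theorem continuous_coe (hk : Continuous (feature H : X → H)) (f : H) : Continuous (f : X → ℝ) := by
  have : (f : X → ℝ) = fun x => ⟪feature H x, f⟫_ℝ := funext fun x => (inner_feature x f).symm
  rw [this]
  fun_prop

variable [CompactSpace X]

theorem norm_feature_sq_le (x : X) : ‖feature H x‖ ^ 2 ≤ ‖K‖ := by
  rw [← real_inner_self_eq_norm_sq, inner_feature_feature H hH]
  exact (le_abs_self _).trans (K.norm_coe_le_norm (x, x))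

/-- The inclusion of `H` into `C(X)`. -/
noncomputable def toContinuous : H →L[ℝ] C(X, ℝ) :=
  LinearMap.mkContinuous
    { toFun := fun f => ⟨f, continuous_coe H (continuous_feature H hH) f⟩
      map_add' := fun f g => by ext; simp
      map_smul' := fun a f => by ext; simp }
    √‖K‖ fun f => (ContinuousMap.norm_le _ (by positivity)).2 fun x => by
      change ‖f x‖ ≤ _
      rw [← inner_feature]
      refine (norm_inner_le_norm _ _).trans ?_
      gcongr
      exact Real.le_sqrt_of_sq_le (norm_feature_sq_le H hH x)

theorem toContinuous_apply (f : H) (x : X) : toContinuous H hH f x = f x := rfl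

variable [MeasurableSpace X] [BorelSpace X] (μ : Measure X) [IsFiniteMeasure μ]

/-- The inclusion of `H` into `L²(μ)`. -/
noncomputable def inclusion : H →L[ℝ] Lp ℝ 2 μ :=
  (ContinuousMap.toLp 2 μ ℝ).comp (toContinuous H hH)

theorem coeFn_inclusion (f : H) : inclusion H hH μ f =ᵐ[μ] f :=
  ContinuousMap.coeFn_toLp (p := 2) μ (𝕜 := ℝ) (toContinuous H hH f)

theorem norm_inclusion_sq (f : H) : ‖inclusion H hH μ f‖ ^ 2 = ∫ x, f x ^ 2 ∂μ := by
  rw [← real_inner_self_eq_norm_sq, L2.inner_def]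
  refine integral_congr_ae ?_
  filter_upwards [coeFn_inclusion H hH μ f] with x hx
  rw [hx]
  simp [sq]

theorem integralOperator_eq :
    integralOperator K μ = inclusion H hH μ ∘L (inclusion H hH μ).adjoint := by
  ext1 w
  change ContinuousMap.toLp 2 μ ℝ (integralToContinuous K μ w)
    = ContinuousMap.toLp 2 μ ℝ (toContinuous H hH ((inclusion H hH μ).adjoint w))
  congr 1
  ext x
  rw [toContinuous_apply, ← inner_feature, ContinuousLinearMap.adjoint_inner_right]
  change ∫ x', K (x, x') * w x' ∂μ = _
  rw [integral_eq_inner]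
  have : kernelSection K x = toContinuous H hH (feature H x) := by
    ext y
    change K (x, y) = feature H x y
    rw [← inner_feature, inner_feature_feature H hH, kernel_symm H hH]
  rw [this]
  rfl

end Inclusion

/-! ### Centered noise -/

section Noise

theorem integrable_of_ae_mem_compact {Y : Type*} [TopologicalSpace Y] [MeasurableSpace Y]
    [OpensMeasurableSpace Y] {P : Measure Y} [IsFiniteMeasure P] {s : Set Y} (hs : IsCompact s)
    (hP : ∀ᵐ y ∂P, y ∈ s) {f : Y → ℝ} (hf : Continuous f) : Integrable f P := by
  obtain ⟨B, hB⟩ := hs.exists_bound_of_continuousOn hf.continuousOn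
  exact Integrable.of_bound hf.aestronglyMeasurable B (hP.mono fun y hy => hB y hy)

theorem ae_abs_snd_le {X ι : Type*} [MeasurableSpace X] [Fintype ι] {ρ : Measure (X × ℝ)}
    [IsProbabilityMeasure ρ] {M : ℝ} (hbdd : ∀ᵐ z ∂ρ, |z.2| ≤ M) :
    ∀ᵐ D ∂(Measure.pi fun _ : ι => ρ), ∀ a, |(D a).2| ≤ M := by
  rw [ae_all_iff]
  exact fun a => (measurePreserving_eval (fun _ : ι => ρ) a).quasiMeasurePreserving.ae hbdd

variable {X : Type*} [MetricSpace X] [CompactSpace X] [MeasurableSpace X] [BorelSpace X]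
  {ρ : Measure (X × ℝ)} [IsProbabilityMeasure ρ] {M : ℝ} (hbdd : ∀ᵐ z ∂ρ, |z.2| ≤ M)
include hbdd

theorem integrable_of_continuous_prod {f : X × ℝ → ℝ} (hf : Continuous f) : Integrable f ρ := by
  refine integrable_of_ae_mem_compact
    ((isCompact_univ (X := X)).prod (isCompact_Icc (a := -M) (b := M))) ?_ hf
  filter_upwards [hbdd] with z hz
  exact ⟨trivial, abs_le.1 hz⟩

variable {ι : Type*} [Fintype ι]

theorem integrable_of_continuous_pi {f : (ι → X × ℝ) → ℝ} (hf : Continuous f) :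
    Integrable f (Measure.pi fun _ : ι => ρ) := by
  refine integrable_of_ae_mem_compact (isCompact_univ_pi fun _ : ι =>
    (isCompact_univ (X := X)).prod (isCompact_Icc (a := -M) (b := M))) ?_ hf
  filter_upwards [ae_abs_snd_le (ι := ι) hbdd] with D hD
  exact fun a _ => ⟨trivial, abs_le.1 (hD a)⟩

omit hbdd in
theorem measurePreserving_fst_pi : MeasurePreserving (fun (D : ι → X × ℝ) a => (D a).1)
    (Measure.pi fun _ : ι => ρ) (Measure.pi fun _ : ι => ρ.fst) :=
  measurePreserving_pi _ _ fun _ => ⟨measurable_fst, rfl⟩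

omit hbdd in
theorem integral_comp_fst_pi {f : (ι → X) → ℝ} (hf : Continuous f) :
    ∫ D, f (fun a => (D a).1) ∂(Measure.pi fun _ : ι => ρ)
      = ∫ x, f x ∂(Measure.pi fun _ : ι => ρ.fst) := by
  rw [← (measurePreserving_fst_pi (ρ := ρ) (ι := ι)).map_eq,
    integral_map (measurePreserving_fst_pi (ρ := ρ)).measurable.aemeasurable hf.aestronglyMeasurable]

variable {g : X → ℝ} (hg : Continuous g) (hreg : regressionFunction ρ =ᵐ[ρ.fst] g)
include hg hreg

theorem integral_noise_mul {φ : X → ℝ} (hφ : Continuous φ) :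
    ∫ z, (z.2 - g z.1) * φ z.1 ∂ρ = 0 := by
  have h1 : Integrable (fun z : X × ℝ => z.2 * φ z.1) ρ :=
    integrable_of_continuous_prod hbdd (by fun_prop)
  have h2 : Integrable (fun z : X × ℝ => g z.1 * φ z.1) ρ :=
    integrable_of_continuous_prod hbdd (by fun_prop)
  simp_rw [sub_mul]
  rw [integral_sub h1 h2, ← Measure.integral_condKernel h1, sub_eq_zero]
  calc ∫ x, ∫ y, y * φ x ∂(ρ.condKernel x) ∂ρ.fst = ∫ x, g x * φ x ∂ρ.fst := by
        refine integral_congr_ae ?_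
        filter_upwards [hreg] with x hx
        rw [integral_mul_const, ← hx, regressionFunction]
    _ = ∫ z, g z.1 * φ z.1 ∂ρ :=
        integral_map measurable_fst.aemeasurable (hg.mul hφ).aestronglyMeasurable

theorem integral_noise_mul_noise {a b : ι} (hab : a ≠ b) {ψ : (ι → X) → ℝ} (hψ : Continuous ψ) :
    ∫ D, ((D a).2 - g (D a).1) * ((D b).2 - g (D b).1) * ψ (fun i => (D i).1)
      ∂(Measure.pi fun _ : ι => ρ) = 0 := by
  classical
  set f : (ι → X × ℝ) → ℝ := fun D =>
    ((D a).2 - g (D a).1) * ((D b).2 - g (D b).1) * ψ (fun i => (D i).1)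
  have hf : Continuous f := by fun_prop
  have hU := measurePreserving_update ρ a
  have hint : Integrable (fun p : (ι → X × ℝ) × X × ℝ => f (Function.update p.1 a p.2))
      ((Measure.pi fun _ : ι => ρ).prod ρ) := hU.integrable_comp_of_integrable (integrable_of_continuous_pi (ι := ι) hbdd hf)
  rw [← hU.map_eq, integral_map hU.measurable.aemeasurable hf.aestronglyMeasurable,
    integral_prod _ hint]
  refine integral_eq_zero_of_ae (.of_forall fun D => ?_)
  have : ∀ z : X × ℝ, f (Function.update D a z) = ((D b).2 - g (D b).1) *
      ((z.2 - g z.1) * ψ (Function.update (fun i => (D i).1) a z.1)) := by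
    intro z
    have e : (fun i => (Function.update D a z i).1) = Function.update (fun i => (D i).1) a z.1 := by
      ext i
      by_cases hi : i = a
      · subst hi; simp
      · simp [hi]
    simp only [f, e, Function.update_self, Function.update_of_ne hab.symm]
    ring
  simp only [this, integral_const_mul]
  rw [integral_noise_mul hbdd hg hreg
    (φ := fun y => ψ (Function.update (fun i => (D i).1) a y))
    (hψ.comp (continuous_const.update a continuous_id)), mul_zero]
  rfl

/-- The cross terms of a sum of centered noises vanish, so the second moment of the sum is at most
the sum of the second moments. -/
theorem integral_norm_sq_sum_noise_le {G : Type*} [NormedAddCommGroup G] [InnerProductSpace ℝ G]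
    {B : ℝ} (hB : ∀ x, |g x| ≤ B) {q : ι → (ι → X) → G} (hq : ∀ a, Continuous (q a)) :
    ∫ D, ‖∑ a, ((D a).2 - g (D a).1) • q a (fun i => (D i).1)‖ ^ 2 ∂(Measure.pi fun _ : ι => ρ)
      ≤ (M + B) ^ 2 * ∑ a, ∫ x, ‖q a x‖ ^ 2 ∂(Measure.pi fun _ : ι => ρ.fst) := by
  classical
  set Q := Measure.pi fun _ : ι => ρ
  have hexp : ∀ D : ι → X × ℝ, ‖∑ a, ((D a).2 - g (D a).1) • q a (fun i => (D i).1)‖ ^ 2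
      = ∑ a, ∑ b, ((D a).2 - g (D a).1) * ((D b).2 - g (D b).1)
          * ⟪q a (fun i => (D i).1), q b (fun i => (D i).1)⟫_ℝ := by
    intro D
    rw [← real_inner_self_eq_norm_sq, sum_inner]
    refine Finset.sum_congr rfl fun a _ => ?_
    rw [inner_sum]
    refine Finset.sum_congr rfl fun b _ => ?_
    rw [inner_smul_left, inner_smul_right]
    simp [mul_assoc]
  simp_rw [hexp]
  have hcont : ∀ a b, Continuous fun D : ι → X × ℝ =>
      ((D a).2 - g (D a).1) * ((D b).2 - g (D b).1)
          * ⟪q a (fun i => (D i).1), q b (fun i => (D i).1)⟫_ℝ := by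
    intro a b
    have := fun a => (hq a).comp (f := fun (D : ι → X × ℝ) i => (D i).1) (by fun_prop)
    have h1 := (this a).inner (𝕜 := ℝ) (this b)
    exact Continuous.mul (by fun_prop) h1
  rw [integral_finsetSum _ fun a _ => integrable_finsetSum _ fun b _ =>
    integrable_of_continuous_pi hbdd (hcont a b), Finset.mul_sum]
  refine Finset.sum_le_sum fun a _ => ?_
  rw [integral_finsetSum _ fun b _ => integrable_of_continuous_pi hbdd (hcont a b),
    Finset.sum_eq_single a (fun b _ hba => integral_noise_mul_noise hbdd hg hreg hba.symm
      ((hq a).inner (hq b))) (fun h => (h (Finset.mem_univ a)).elim),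
    ← integral_comp_fst_pi (f := fun x => ‖q a x‖ ^ 2) (((hq a).norm).pow 2), ← integral_const_mul]
  refine integral_mono_ae (integrable_of_continuous_pi hbdd (hcont a a))
    ((integrable_of_continuous_pi hbdd ?_).const_mul _) ?_
  · exact (((hq a).comp (f := fun (D : ι → X × ℝ) i => (D i).1) (by fun_prop)).norm).pow 2
  · filter_upwards [ae_abs_snd_le (ι := ι) hbdd] with D hD
    rw [real_inner_self_eq_norm_sq, ← sq]
    gcongr ?_ * _
    refine sq_le_sq.2 ((abs_sub _ _).trans ?_ |>.trans (le_abs_self _))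
    exact add_le_add (hD a) (hB _)

end Noise

/-! ### Kernel ridge regression -/

section Estimator

variable {X : Type*} {H : Type*} [NormedAddCommGroup H] [InnerProductSpace ℝ H] [CompleteSpace H]
  [RKHS ℝ H X ℝ]

/-- The normal equations: kernel ridge regression is `(k λ I + ∑ K_x ⊗ K_x)⁻¹ ∑ y K_x`. -/
theorem krr_eq_ridge {k : ℕ} (hk : 1 ≤ k) (D : Fin k → X × ℝ) {lam : ℝ} (hlam : 0 < lam) :
    krr H D lam = ridge (sampleOp Finset.univ fun i => feature H (D i).1) (k * lam)
      (∑ i, (D i).2 • feature H (D i).1) := by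
  have hk0 : (0 : ℝ) < k := by exact_mod_cast hk
  have hT := isPositive_sampleOp Finset.univ fun i => feature H (D i).1
  have hA := smul_ridge_add hT (mul_pos hk0 hlam) (∑ i, (D i).2 • feature H (D i).1)
  set u := ridge (sampleOp Finset.univ fun i => feature H (D i).1) (k * lam)
    (∑ i, (D i).2 • feature H (D i).1)
  have hkey : ∀ f : H, krrObjective H D lam f = krrObjective H D lam u
      + ((1 / (k : ℝ)) * ∑ i, (f - u) (D i).1 ^ 2 + lam * ‖f - u‖ ^ 2) := by
    intro f
    have h1 : (k * lam) * ⟪u, f - u⟫_ℝ + ∑ i, u (D i).1 * (f - u) (D i).1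
        = ∑ i, (D i).2 * (f - u) (D i).1 := by
      have := congrArg (fun z => ⟪z, f - u⟫_ℝ) hA
      simp only [inner_add_left, inner_smul_left, sampleOp_apply, sum_inner, inner_feature,
        conj_trivial] at this
      exact this
    have h2 : ‖f‖ ^ 2 = ‖u‖ ^ 2 + 2 * ⟪u, f - u⟫_ℝ + ‖f - u‖ ^ 2 := by
      rw [← norm_add_sq_real, add_sub_cancel]
    have h3 : ∑ i, (f (D i).1 - (D i).2) ^ 2 = ∑ i, (u (D i).1 - (D i).2) ^ 2
        + 2 * (∑ i, u (D i).1 * (f - u) (D i).1 - ∑ i, (D i).2 * (f - u) (D i).1)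
        + ∑ i, (f - u) (D i).1 ^ 2 := by
      rw [← Finset.sum_sub_distrib, Finset.mul_sum, ← Finset.sum_add_distrib,
        ← Finset.sum_add_distrib]
      refine Finset.sum_congr rfl fun i _ => ?_
      simp only [RKHS.coe_sub, Pi.sub_apply]
      ring
    rw [krrObjective, krrObjective, h3, h2, ← h1]
    field_simp
    ring
  have hmin : IsMinOn (krrObjective H D lam) Set.univ u := fun f _ => by
    change krrObjective H D lam u ≤ krrObjective H D lam f
    rw [hkey f]
    have : 0 ≤ (1 / (k : ℝ)) * ∑ i, (f - u) (D i).1 ^ 2 + lam * ‖f - u‖ ^ 2 := by positivity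
    linarith
  have hmin' : IsMinOn (krrObjective H D lam) Set.univ (krr H D lam) :=
    Classical.epsilon_spec (p := fun f : H => IsMinOn (krrObjective H D lam) Set.univ f) ⟨u, hmin⟩
  have h1 := hmin' (Set.mem_univ u)
  change krrObjective H D lam (krr H D lam) ≤ krrObjective H D lam u at h1
  rw [hkey] at h1
  have h2 : 0 ≤ (1 / (k : ℝ)) * ∑ i, (krr H D lam - u) (D i).1 ^ 2 := by positivity
  have h3 : ‖krr H D lam - u‖ ^ 2 = 0 :=
    le_antisymm (nonpos_of_mul_nonpos_right (by linarith) hlam) (by positivity)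
  exact sub_eq_zero.1 (norm_eq_zero.1 (pow_eq_zero_iff two_ne_zero |>.1 h3))

end Estimator

/-! ### The bias of one machine -/

section Bias

variable {X : Type*} [MetricSpace X] [CompactSpace X] [MeasurableSpace X] [BorelSpace X]
  {μ : Measure X} [IsProbabilityMeasure μ]
  {H : Type*} [NormedAddCommGroup H] [InnerProductSpace ℝ H] [CompleteSpace H]
  {G : Type*} [NormedAddCommGroup G] [InnerProductSpace ℝ G] [CompleteSpace G]
  {k : X → H} {S : H →L[ℝ] G} {κ lam : ℝ} {ι : Type*} [Fintype ι] {F : Finset ι}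

/-- The bias of ridge regression with noiseless outputs is `-c R f`, where `c = |F| λ`. -/
theorem integral_norm_sq_bias_le (hk : Continuous k)
    (hS : ∀ g, ‖S g‖ ^ 2 = ∫ x, ⟪k x, g⟫_ℝ ^ 2 ∂μ) (hκ : ∀ x, ‖k x‖ ^ 2 ≤ κ) (hκ0 : 0 ≤ κ)
    (hF : F.Nonempty) (hlam : 0 < lam) {r B C : ℝ} (hC : 1 + κ / (F.card * lam) ≤ C) {w : G} {v : H}
    (hw : ‖w‖ ≤ lam ^ (r - 1) * B) (hv : ‖v‖ ≤ lam ^ (r - 1 / 2) * B) :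
    ∫ D, ‖S ((F.card * lam) • sampleRidge k F (F.card * lam) D (S.adjoint w + v))‖ ^ 2
        ∂(Measure.pi fun _ : ι => μ)
      ≤ 4 * C ^ 4 * lam ^ (2 * r) * B ^ 2 := by
  have hcard : (0 : ℝ) < F.card := by exact_mod_cast hF.card_pos
  have hc : 0 < F.card * lam := mul_pos hcard hlam
  have hC0 : 1 ≤ 1 + κ / (F.card * lam) := le_add_of_nonneg_right (by positivity)
  have h1 := integral_norm_sq_sampleRidge_le (ι := ι) hk hS hκ hF hc (S.adjoint w + v)
  have h2 := integral_inner_sampleRidge_le (ι := ι) hk hS hκ hF hc hκ0 w v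
  have hpow : ∀ b e : ℝ, 2 * r = 2 * b + e → (lam ^ b) ^ 2 = lam ^ (2 * r) / lam ^ e := by
    intro b e h
    rw [eq_div_iff (by positivity), ← Real.rpow_natCast, ← Real.rpow_mul hlam.le,
      ← Real.rpow_add hlam, h]
    congr 1; push_cast; ring
  have e1 := hpow (r - 1) 2 (by ring)
  have e2 := hpow (r - 1 / 2) 1 (by ring)
  rw [Real.rpow_one] at e2
  rw [Real.rpow_two] at e1
  have hw2 : ‖w‖ ^ 2 ≤ lam ^ (2 * r) / lam ^ 2 * B ^ 2 := by rw [← e1, ← mul_pow]; gcongr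
  have hv2 : ‖v‖ ^ 2 ≤ lam ^ (2 * r) / lam * B ^ 2 := by rw [← e2, ← mul_pow]; gcongr
  simp_rw [map_smul, norm_smul, mul_pow, Real.norm_eq_abs, sq_abs]
  rw [integral_const_mul]
  set C' := 1 + κ / (F.card * lam)
  have hC1 : 1 ≤ C := hC0.trans hC
  calc (F.card * lam) ^ 2 * _
      ≤ (F.card * lam) ^ 2 * (C ^ 2 / F.card
          * (2 * (C ^ 2 / F.card * (lam ^ (2 * r) / lam ^ 2 * B ^ 2))
            + 2 * (C ^ 2 * (lam ^ (2 * r) / lam * B ^ 2) / (F.card * lam)))) := by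
        gcongr
        refine h1.trans ?_
        gcongr
        · exact integral_nonneg fun D => inner_ridge_nonneg (isPositive_sampleOp _ _) hc _
        refine h2.trans ?_
        gcongr
        exact hv2.trans (le_mul_of_one_le_left (by positivity) (by nlinarith))
    _ = 4 * C ^ 4 * lam ^ (2 * r) * B ^ 2 := by
        field_simp
        ring

end Bias

/-! ### Bias-variance decomposition of the distributed estimator -/

section Distributed

variable {X : Type*} {H : Type*} [NormedAddCommGroup H] [InnerProductSpace ℝ H] [CompleteSpace H]
  [RKHS ℝ H X ℝ] {m : ℕ} {n : Fin m → ℕ}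

/-- The indices of the samples held by the machine `j`. -/
def block (n : Fin m → ℕ) (j : Fin m) : Finset (Σ j : Fin m, Fin (n j)) :=
  Finset.univ.map (Function.Embedding.sigmaMk j)

theorem card_block (j : Fin m) : (block n j).card = n j := by simp [block]

theorem sum_block {V : Type*} [AddCommMonoid V] (j : Fin m) (φ : (Σ j : Fin m, Fin (n j)) → V) :
    ∑ a ∈ block n j, φ a = ∑ i, φ ⟨j, i⟩ := by
  simp [block, Finset.sum_map]

variable (H) in
/-- The resolvent of the empirical covariance operator of the machine `j`. -/
noncomputable def machineRidge (n : Fin m → ℕ) (lam : Fin m → ℝ) (j : Fin m)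
    (x : (Σ j : Fin m, Fin (n j)) → X) : H →L[ℝ] H :=
  sampleRidge (feature H) (block n j) ((block n j).card * lam j) x

theorem krr_sub_eq (D : (Σ j : Fin m, Fin (n j)) → X × ℝ) (hn : ∀ j, 1 ≤ n j) {lam : Fin m → ℝ}
    (hlam : ∀ j, 0 < lam j) (f : H) (j : Fin m) :
    krr H (fun i => D ⟨j, i⟩) (lam j) - f
      = -((block n j).card * lam j) • machineRidge H n lam j (fun a => (D a).1) f
        + ∑ i : Fin (n j), ((D ⟨j, i⟩).2 - f (D ⟨j, i⟩).1)
            • machineRidge H n lam j (fun a => (D a).1) (feature H (D ⟨j, i⟩).1) := by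
  have hc : 0 < (n j : ℝ) * lam j := mul_pos (by exact_mod_cast hn j) (hlam j)
  have hop : sampleOp Finset.univ (fun i => feature H (D ⟨j, i⟩).1)
      = sampleOp (block n j) (fun a => feature H (D a).1) := by
    rw [sampleOp, sampleOp, sum_block]
  have hT := isPositive_sampleOp (block n j) (fun a => feature H (D a).1)
  rw [krr_eq_ridge (hn j) _ (hlam j), hop, machineRidge, sampleRidge, card_block]
  set T := sampleOp (block n j) (fun a => feature H (D a).1)
  have hTf : T f = ∑ i : Fin (n j), f (D ⟨j, i⟩).1 • feature H (D ⟨j, i⟩).1 := by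
    rw [sampleOp_apply, sum_block]
    simp_rw [inner_feature]
  have hf : f = ridge T (n j * lam j) ((n j * lam j) • f + T f) :=
    (ridge_eq_of_smul_add hT hc rfl).symm
  conv_lhs => rw [hf, hTf]
  simp only [map_add, map_smul, map_sum, sub_smul, Finset.sum_sub_distrib]
  module

theorem dkrr_sub_eq (D : (Σ j : Fin m, Fin (n j)) → X × ℝ) (hn : ∀ j, 1 ≤ n j)
    (hN : ∑ j, n j ≠ 0) {lam : Fin m → ℝ} (hlam : ∀ j, 0 < lam j) (f : H) :
    dkrr H n D lam - f
      = -∑ j, ((n j : ℝ) / ((∑ i, n i : ℕ) : ℝ)) • ((block n j).card * lam j)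
            • machineRidge H n lam j (fun a => (D a).1) f
        + ∑ a, ((D a).2 - f (D a).1) • ((n a.1 : ℝ) / ((∑ i, n i : ℕ) : ℝ))
            • machineRidge H n lam a.1 (fun a => (D a).1) (feature H (D a).1) := by
  have hw : ∑ j, (n j : ℝ) / ((∑ i, n i : ℕ) : ℝ) = 1 := by
    rw [← Finset.sum_div, ← Nat.cast_sum, div_self (by exact_mod_cast hN)]
  have hf : f = ∑ j, ((n j : ℝ) / ((∑ i, n i : ℕ) : ℝ)) • f := by
    rw [← Finset.sum_smul, hw, one_smul]
  conv_lhs => rw [hf]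
  rw [dkrr, ← Finset.sum_sub_distrib, Fintype.sum_sigma, ← Finset.sum_neg_distrib,
    ← Finset.sum_add_distrib]
  refine Finset.sum_congr rfl fun j _ => ?_
  rw [← smul_sub, krr_sub_eq D hn hlam f j, smul_add, Finset.smul_sum, neg_smul, smul_neg]
  congr 1
  exact Finset.sum_congr rfl fun i _ => smul_comm _ _ _

end Distributed

section Error

variable {X : Type*} [MetricSpace X] [CompactSpace X] [MeasurableSpace X] [BorelSpace X]
  {K : C(X × X, ℝ)} {H : Type*} [NormedAddCommGroup H] [InnerProductSpace ℝ H] [CompleteSpace H]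
  [RKHS ℝ H X ℝ] (hH : ∀ x y : X, RKHS.kernel H x y 1 = K (x, y))
  {ρ : Measure (X × ℝ)} [IsProbabilityMeasure ρ] {M : ℝ} (hbdd : ∀ᵐ z ∂ρ, |z.2| ≤ M)
  {f : H} (hreg : regressionFunction ρ =ᵐ[ρ.fst] f)
  {m : ℕ} {n : Fin m → ℕ} (hn : ∀ j, 1 ≤ n j) (hN : ∑ j, n j ≠ 0)
  {lam : Fin m → ℝ} (hlam : ∀ j, 0 < lam j)
include hH

omit [IsProbabilityMeasure ρ] in
theorem dkrrError_eq [IsFiniteMeasure ρ] (hreg : regressionFunction ρ =ᵐ[ρ.fst] f)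
    (D : (Σ j : Fin m, Fin (n j)) → X × ℝ) :
    dkrrError H ρ n lam D = ‖inclusion H hH ρ.fst (dkrr H n D lam - f)‖ ^ 2 := by
  rw [norm_inclusion_sq, dkrrError]
  refine integral_congr_ae ?_
  filter_upwards [hreg] with x hx
  rw [hx, RKHS.coe_sub, Pi.sub_apply]

omit [CompactSpace X] [MeasurableSpace X] [BorelSpace X] in
include hn hlam in
theorem continuous_machineRidge (j : Fin m) :
    Continuous (machineRidge (X := X) H n lam j) := by
  refine continuous_sampleRidge (continuous_feature H hH) ?_
  rw [card_block]
  exact mul_pos (by exact_mod_cast hn j) (hlam j)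

omit [CompactSpace X] [MeasurableSpace X] [BorelSpace X] in
include hn hN hlam in
theorem continuous_dkrr : Continuous fun D : (Σ j : Fin m, Fin (n j)) → X × ℝ => dkrr H n D lam := by
  have h : ∀ D : (Σ j : Fin m, Fin (n j)) → X × ℝ, dkrr H n D lam = _ := fun D => by
    rw [← sub_zero (dkrr H n D lam), dkrr_sub_eq D hn hN hlam (0 : H)]
  simp_rw [h]
  have hR := fun j => (continuous_machineRidge hH hn hlam j).comp
    (f := fun (D : (Σ j : Fin m, Fin (n j)) → X × ℝ) a => (D a).1) (by fun_prop)
  have hk := continuous_feature H hH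
  simp only [Function.comp_def] at hR
  simp only [RKHS.coe_zero, Pi.zero_apply]
  fun_prop

include hbdd hreg hn hN hlam in
theorem integrable_dkrrError :
    Integrable (dkrrError H ρ n lam) (Measure.pi fun _ => ρ) := by
  have h : dkrrError H ρ n lam = fun D => ‖inclusion H hH ρ.fst (dkrr H n D lam - f)‖ ^ 2 :=
    funext fun D => dkrrError_eq hH hreg D
  have := continuous_dkrr hH hn hN hlam
  rw [h]
  exact integrable_of_continuous_pi hbdd (by fun_prop)

include hbdd hreg hn hN hlam in
/-- Averaging over the machines does not reduce the bias terms (first sum), but the noise terms are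
uncorrelated, and the squares of the weights enter (second sum). -/
theorem integral_dkrrError_le {r B C : ℝ}
    (hC : ∀ j, 1 + ‖K‖ / (n j * lam j) ≤ C)
    (hdec : ∀ lam : ℝ, 0 < lam → ∃ (w : Lp ℝ 2 ρ.fst) (v : H),
      f = (inclusion H hH ρ.fst).adjoint w + v ∧ ‖w‖ ≤ lam ^ (r - 1) * B
        ∧ ‖v‖ ≤ lam ^ (r - 1 / 2) * B)
    {d : Fin m → ℝ} (hd0 : ∀ j, 0 ≤ d j)
    (hd : ∀ j, effectiveDimension (integralOperator K ρ.fst) (lam j) ≤ ENNReal.ofReal (d j)) :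
    ∫ D, dkrrError H ρ n lam D ∂(Measure.pi fun _ => ρ)
      ≤ 8 * C ^ 4 * B ^ 2 * ∑ j, (n j : ℝ) / ((∑ i, n i : ℕ) : ℝ) * lam j ^ (2 * r)
        + 2 * (M + ‖toContinuous H hH f‖) ^ 2 * (2 * C ^ 2 + 2)
          * ∑ j, ((n j : ℝ) / ((∑ i, n i : ℕ) : ℝ)) ^ 2 * (d j / n j) := by
  have : Fact ((2 : ℝ≥0∞) ≠ ⊤) := ⟨ENNReal.ofNat_ne_top⟩
  set S := inclusion H hH ρ.fst
  set N : ℝ := ((∑ i, n i : ℕ) : ℝ)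
  have hN0 : 0 < N := Nat.cast_pos.2 (Nat.pos_of_ne_zero hN)
  have hn0 : ∀ j, (0 : ℝ) < n j := fun j => by exact_mod_cast hn j
  have hk := continuous_feature H hH
  have hκ := norm_feature_sq_le H hH
  have hcR := continuous_machineRidge hH hn hlam
  have hS : ∀ g, ‖S g‖ ^ 2 = ∫ x, ⟪feature H x, g⟫_ℝ ^ 2 ∂ρ.fst := fun g => by
    simp_rw [inner_feature]; exact norm_inclusion_sq H hH ρ.fst g
  have hblock : ∀ j, (block n j).Nonempty := fun j => by
    rw [← Finset.card_pos, card_block]; exact hn j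
  have hw : ∑ j, (n j : ℝ) / N = 1 := by
    rw [← Finset.sum_div, ← Nat.cast_sum, div_self hN0.ne']
  -- the bias and noise parts of the error
  set b : Fin m → ((Σ j : Fin m, Fin (n j)) → X) → Lp ℝ 2 ρ.fst := fun j x =>
    S (((block n j).card * lam j) • machineRidge H n lam j x f)
  set q : (Σ j : Fin m, Fin (n j)) → ((Σ j : Fin m, Fin (n j)) → X) → Lp ℝ 2 ρ.fst := fun a x =>
    ((n a.1 : ℝ) / N) • S (machineRidge H n lam a.1 x (feature H (x a)))
  have hb : ∀ j, Continuous (b j) := fun j => by fun_prop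
  have hq : ∀ a, Continuous (q a) := fun a => by fun_prop
  have hfst : Continuous fun (D : (Σ j : Fin m, Fin (n j)) → X × ℝ) a => (D a).1 := by fun_prop
  have hf : Continuous (f : X → ℝ) := continuous_coe H hk f
  have hbD := fun j => (hb j).comp hfst
  have hqD := fun a => (hq a).comp hfst
  simp only [Function.comp_def] at hbD hqD
  have hpt : ∀ D, dkrrError H ρ n lam D
      ≤ 2 * ∑ j, (n j : ℝ) / N * ‖b j (fun a => (D a).1)‖ ^ 2
        + 2 * ‖∑ a, ((D a).2 - f (D a).1) • q a (fun a => (D a).1)‖ ^ 2 := by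
    intro D
    rw [dkrrError_eq hH hreg, dkrr_sub_eq D hn hN hlam f]
    have e : S (-∑ j, ((n j : ℝ) / N) • ((block n j).card * lam j)
          • machineRidge H n lam j (fun a => (D a).1) f
        + ∑ a, ((D a).2 - f (D a).1) • ((n a.1 : ℝ) / N)
          • machineRidge H n lam a.1 (fun a => (D a).1) (feature H (D a).1))
        = -∑ j, ((n j : ℝ) / N) • b j (fun a => (D a).1)
          + ∑ a, ((D a).2 - f (D a).1) • q a (fun a => (D a).1) := by
      simp only [map_add, map_neg, map_sum, map_smul, b, q]
    rw [e]
    set y := ∑ a, ((D a).2 - f (D a).1) • q a (fun a => (D a).1)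
    have h1 : ‖∑ j, ((n j : ℝ) / N) • b j (fun a => (D a).1)‖ ^ 2
        ≤ ∑ j, (n j : ℝ) / N * ‖b j (fun a => (D a).1)‖ ^ 2 := by
      refine le_trans (pow_le_pow_left₀ (norm_nonneg _) ?_ 2)
        (Real.pow_arith_mean_le_arith_mean_pow Finset.univ (fun j => (n j : ℝ) / N)
          (fun j => ‖b j (fun a => (D a).1)‖) (fun j _ => by positivity) hw
          (fun j _ => norm_nonneg _) 2)
      refine norm_sum_le_of_le _ fun j _ => ?_
      rw [norm_smul, Real.norm_of_nonneg (by positivity)]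
    set z := ∑ j, ((n j : ℝ) / N) • b j (fun a => (D a).1)
    have h2 := parallelogram_law_with_norm ℝ (-z) y
    rw [norm_neg] at h2
    nlinarith [mul_self_nonneg ‖-z - y‖]
  have hbias : ∀ j, ∫ D, ‖b j (fun a => (D a).1)‖ ^ 2 ∂(Measure.pi fun _ => ρ)
      ≤ 4 * C ^ 4 * lam j ^ (2 * r) * B ^ 2 := by
    intro j
    rw [integral_comp_fst_pi (f := fun x => ‖b j x‖ ^ 2) (by fun_prop)]
    obtain ⟨w, v, hfw, hwn, hvn⟩ := hdec (lam j) (hlam j)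
    have := integral_norm_sq_bias_le (ι := Σ j : Fin m, Fin (n j)) (F := block n j) hk hS hκ
      (norm_nonneg K) (hblock j) (hlam j) (C := C) (by rw [card_block]; exact hC j) hwn hvn
    rw [← hfw] at this
    exact this
  have hnoise : ∫ D, ‖∑ a, ((D a).2 - f (D a).1) • q a (fun a => (D a).1)‖ ^ 2
        ∂(Measure.pi fun _ => ρ)
      ≤ (M + ‖toContinuous H hH f‖) ^ 2 * ∑ j, ((n j : ℝ) / N) ^ 2
          * ((2 * C ^ 2 + 2) / n j * d j) := by
    refine (integral_norm_sq_sum_noise_le hbdd hf hreg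
      (fun x => (toContinuous H hH f).norm_coe_le_norm x) hq).trans ?_
    gcongr
    rw [Fintype.sum_sigma]
    refine Finset.sum_le_sum fun j _ => ?_
    rw [← integral_finsetSum _ fun i _ => integrable_of_continuous (by fun_prop)]
    simp only [q, norm_smul, mul_pow, Real.norm_eq_abs, sq_abs]
    simp_rw [← Finset.mul_sum]
    rw [integral_const_mul]
    gcongr
    have := integral_sum_norm_sq_sampleRidge_le (ι := Σ j : Fin m, Fin (n j)) (F := block n j) hk
      hS hκ (norm_nonneg K) (hblock j) (hlam j) (hd0 j)
      (by rw [← integralOperator_eq]; exact hd j)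
    simp_rw [sum_block] at this
    refine this.trans ?_
    rw [card_block]
    have := hd0 j
    have hC' := hC j
    have : 0 ≤ 1 + ‖K‖ / (n j * lam j) := by have := hlam j; positivity
    gcongr
  calc ∫ D, dkrrError H ρ n lam D ∂(Measure.pi fun _ => ρ)
      ≤ ∫ D, (2 * ∑ j, (n j : ℝ) / N * ‖b j (fun a => (D a).1)‖ ^ 2
        + 2 * ‖∑ a, ((D a).2 - f (D a).1) • q a (fun a => (D a).1)‖ ^ 2)
          ∂(Measure.pi fun _ => ρ) :=
        integral_mono (integrable_dkrrError hH hbdd hreg hn hN hlam)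
          (integrable_of_continuous_pi hbdd (by fun_prop)) hpt
    _ = 2 * ∑ j, (n j : ℝ) / N * ∫ D, ‖b j (fun a => (D a).1)‖ ^ 2 ∂(Measure.pi fun _ => ρ)
        + 2 * ∫ D, ‖∑ a, ((D a).2 - f (D a).1) • q a (fun a => (D a).1)‖ ^ 2
          ∂(Measure.pi fun _ => ρ) := by
        rw [integral_add (integrable_of_continuous_pi hbdd (by fun_prop))
          (integrable_of_continuous_pi hbdd (by fun_prop)), integral_const_mul,
          integral_const_mul, integral_finsetSum _ fun j _ =>
            integrable_of_continuous_pi hbdd (by fun_prop)]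
        simp_rw [integral_const_mul]
    _ ≤ 2 * ∑ j, (n j : ℝ) / N * (4 * C ^ 4 * lam j ^ (2 * r) * B ^ 2)
        + 2 * ((M + ‖toContinuous H hH f‖) ^ 2 * ∑ j, ((n j : ℝ) / N) ^ 2
          * ((2 * C ^ 2 + 2) / n j * d j)) := by
        gcongr with j
        exact hbias j
    _ = _ := by
        simp only [Finset.mul_sum]
        congr 1 <;> refine Finset.sum_congr rfl fun j _ => by ring

end Error

/-! ### The rate for the prescribed regularization parameters -/

section Rate

variable {C₁ r s : ℝ} {N k : ℕ}

theorem le_regParam (hC₁ : 0 < C₁) (hk : 1 ≤ k) :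
    C₁ * (N : ℝ) ^ (-(1 / (2 * r + s))) ≤ regParam C₁ r s N k := by
  have hk0 : (0 : ℝ) < k := by exact_mod_cast hk
  rw [regParam]
  split_ifs with h
  · exact le_rfl
  · rw [not_le] at h
    gcongr
    rcases eq_or_ne ((N : ℝ) ^ (1 / (2 * r + s))) 0 with h0 | h0
    · rw [Real.rpow_neg (by positivity), h0, inv_zero]
      positivity
    · have hp : 0 < (N : ℝ) ^ (1 / (2 * r + s)) := lt_of_le_of_ne (by positivity) h0.symm
      rw [Real.rpow_neg (by positivity), inv_le_iff_one_le_mul₀ hp]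
      have : (1 : ℝ) ≤ (N : ℝ) ^ (1 / (2 * r + s)) * Real.log N ^ 4 / k := by
        rw [le_div_iff₀ hk0]; linarith
      calc (1 : ℝ) ≤ (N : ℝ) ^ (1 / (2 * r + s)) * Real.log N ^ 4 / k := this
        _ = _ := by field_simp

theorem regParam_pos (hC₁ : 0 < C₁) (hk : 1 ≤ k) (hN : 2 ≤ N) : 0 < regParam C₁ r s N k := by
  have : (0 : ℝ) < N := by positivity
  exact lt_of_lt_of_le (by positivity) (le_regParam hC₁ hk)

/-- The prescribed parameters keep `k λ` bounded away from zero. -/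
theorem le_mul_regParam (hC₁ : 0 < C₁) (hk : 1 ≤ k) (hN : 2 ≤ N) :
    C₁ * Real.log 2 ^ 4 ≤ k * regParam C₁ r s N k := by
  have hk0 : (0 : ℝ) < k := by exact_mod_cast hk
  have hN0 : (0 : ℝ) < N := by positivity
  have hlog : Real.log 2 ≤ Real.log N := Real.log_le_log (by norm_num) (by exact_mod_cast hN)
  have hlog2 : 0 < Real.log 2 := Real.log_pos (by norm_num)
  have h1 : C₁ * Real.log 2 ^ 4 ≤ C₁ * Real.log N ^ 4 := by gcongr
  refine h1.trans ?_
  rw [regParam]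
  split_ifs with h
  · have hp : 0 < (N : ℝ) ^ (1 / (2 * r + s)) := by positivity
    calc C₁ * Real.log N ^ 4
        = C₁ * ((N : ℝ) ^ (1 / (2 * r + s)) * Real.log N ^ 4
            * (N : ℝ) ^ (-(1 / (2 * r + s)))) := by
          rw [Real.rpow_neg hN0.le]; field_simp
      _ ≤ C₁ * (k * (N : ℝ) ^ (-(1 / (2 * r + s)))) := by gcongr
      _ = _ := by ring
  · exact le_of_eq (by field_simp)

theorem mul_regParam_rpow_le (hC₁ : 0 < C₁) (hr : 1 / 2 ≤ r) (hk : 1 ≤ k) (hN : 2 ≤ N) :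
    (k : ℝ) / N * regParam C₁ r s N k ^ (2 * r)
      ≤ C₁ ^ (2 * r) * ((k : ℝ) / N * (N : ℝ) ^ (-(2 * r / (2 * r + s)))
          + Real.log N ^ (8 * r) / N) := by
  have hk0 : (0 : ℝ) < k := by exact_mod_cast hk
  have hN0 : (0 : ℝ) < N := by positivity
  have hlog : 0 < Real.log N := Real.log_pos (by exact_mod_cast hN)
  rw [regParam]
  split_ifs with h
  · rw [Real.mul_rpow hC₁.le (by positivity), ← Real.rpow_mul hN0.le]
    have : -(1 / (2 * r + s)) * (2 * r) = -(2 * r / (2 * r + s)) := by ring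
    rw [this, mul_add, mul_left_comm]
    exact le_add_of_nonneg_right (by positivity)
  · have e : (Real.log N ^ 4) ^ (2 * r) = Real.log N ^ (8 * r) := by
      rw [← Real.rpow_natCast, ← Real.rpow_mul hlog.le]
      congr 1; push_cast; ring
    rw [Real.mul_rpow hC₁.le (by positivity), Real.mul_rpow (by positivity) (by positivity), e,
      Real.inv_rpow hk0.le]
    have hk1 : (k : ℝ) * ((k : ℝ) ^ (2 * r))⁻¹ ≤ 1 := by
      rw [mul_inv_le_iff₀ (by positivity), one_mul]
      exact Real.self_le_rpow_of_one_le (by exact_mod_cast hk) (by linarith)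
    calc (k : ℝ) / N * (C₁ ^ (2 * r) * (((k : ℝ) ^ (2 * r))⁻¹ * Real.log N ^ (8 * r)))
        = C₁ ^ (2 * r) * ((k * ((k : ℝ) ^ (2 * r))⁻¹) * (Real.log N ^ (8 * r) / N)) := by ring
      _ ≤ C₁ ^ (2 * r) * (1 * (Real.log N ^ (8 * r) / N)) := by gcongr
      _ ≤ _ := by
        rw [one_mul]
        gcongr
        exact le_add_of_nonneg_left (by positivity)

variable {m : ℕ} {n : Fin m → ℕ}

theorem rpow_div_self (hr : 1 / 2 ≤ r) (hs : 0 < s) (hN : 2 ≤ N) :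
    (N : ℝ) ^ (s / (2 * r + s)) / N = (N : ℝ) ^ (-(2 * r / (2 * r + s))) := by
  have hN0 : (0 : ℝ) < N := by positivity
  rw [← Real.rpow_sub_one hN0.ne']
  congr 1
  field_simp [show 2 * r + s ≠ 0 by linarith]
  ring

/-- The bound on the number of machines makes the contribution of the small machines to the bias
no larger than the rate. -/
theorem sum_mul_regParam_rpow_le (hC₁ : 0 < C₁) (hr : 1 / 2 ≤ r) (hs : 0 < s)
    (hn : ∀ j, 1 ≤ n j) (hNn : N = ∑ j, n j) (hN : 2 ≤ N)
    (hm : (m : ℝ) ≤ (N : ℝ) ^ (s / (2 * r + s)) * Real.log N ^ (-(8 * r))) :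
    ∑ j, (n j : ℝ) / N * regParam C₁ r s N (n j) ^ (2 * r)
      ≤ 2 * C₁ ^ (2 * r) * (N : ℝ) ^ (-(2 * r / (2 * r + s))) := by
  have hN0 : (0 : ℝ) < N := by positivity
  have hlog : 0 < Real.log N := Real.log_pos (by exact_mod_cast hN)
  have hw : ∑ j, (n j : ℝ) / N = 1 := by
    rw [← Finset.sum_div, ← Nat.cast_sum, ← hNn, div_self hN0.ne']
  have hm' : (m : ℝ) * Real.log N ^ (8 * r) ≤ (N : ℝ) ^ (s / (2 * r + s)) := by
    rwa [Real.rpow_neg hlog.le, ← div_eq_mul_inv, le_div_iff₀ (by positivity)] at hm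
  calc _ ≤ ∑ j, C₁ ^ (2 * r) * ((n j : ℝ) / N * (N : ℝ) ^ (-(2 * r / (2 * r + s)))
          + Real.log N ^ (8 * r) / N) :=
        Finset.sum_le_sum fun j _ => mul_regParam_rpow_le hC₁ hr (hn j) hN
    _ = C₁ ^ (2 * r) * ((N : ℝ) ^ (-(2 * r / (2 * r + s))) + m * Real.log N ^ (8 * r) / N) := by
        rw [← Finset.mul_sum, Finset.sum_add_distrib, ← Finset.sum_mul, hw]
        simp [mul_div_assoc]
    _ ≤ C₁ ^ (2 * r) * ((N : ℝ) ^ (-(2 * r / (2 * r + s)))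
          + (N : ℝ) ^ (s / (2 * r + s)) / N) := by gcongr
    _ = _ := by rw [rpow_div_self hr hs hN]; ring

theorem sum_sq_mul_regParam_rpow_le (hC₁ : 0 < C₁) (hr : 1 / 2 ≤ r) (hs : 0 < s)
    (hn : ∀ j, 1 ≤ n j) (hNn : N = ∑ j, n j) (hN : 2 ≤ N) {C₀ : ℝ} (hC₀ : 0 ≤ C₀) :
    ∑ j, ((n j : ℝ) / N) ^ 2 * (C₀ * regParam C₁ r s N (n j) ^ (-s) / n j)
      ≤ C₀ * C₁ ^ (-s) * (N : ℝ) ^ (-(2 * r / (2 * r + s))) := by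
  have hN0 : (0 : ℝ) < N := by positivity
  have hw : ∑ j, (n j : ℝ) / N = 1 := by
    rw [← Finset.sum_div, ← Nat.cast_sum, ← hNn, div_self hN0.ne']
  have hlam : ∀ j, regParam C₁ r s N (n j) ^ (-s) ≤ C₁ ^ (-s) * (N : ℝ) ^ (s / (2 * r + s)) := by
    intro j
    refine (Real.rpow_le_rpow_of_nonpos (by positivity) (le_regParam hC₁ (hn j))
      (by linarith)).trans (le_of_eq ?_)
    rw [Real.mul_rpow hC₁.le (by positivity), ← Real.rpow_mul hN0.le]
    congr 2
    ring
  calc _ ≤ ∑ j, (n j : ℝ) / N * (C₀ * (C₁ ^ (-s) * (N : ℝ) ^ (s / (2 * r + s))) / N) := by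
        refine Finset.sum_le_sum fun j _ => ?_
        have hj : (0 : ℝ) < n j := by exact_mod_cast hn j
        calc ((n j : ℝ) / N) ^ 2 * (C₀ * regParam C₁ r s N (n j) ^ (-s) / n j)
            = (n j : ℝ) / N * (C₀ * regParam C₁ r s N (n j) ^ (-s) / N) := by field_simp
          _ ≤ _ := by
            gcongr
            exact hlam j
    _ = C₀ * C₁ ^ (-s) * ((N : ℝ) ^ (s / (2 * r + s)) / N) := by
        rw [← Finset.sum_mul, hw]; ring
    _ = _ := by rw [rpow_div_self hr hs hN]

end Rate

end DKRR

theorem theorem1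
    {X : Type*} [MetricSpace X] [CompactSpace X] [MeasurableSpace X] [BorelSpace X]
    -- the Mercer kernel `K` (continuous; symmetric and positive semidefinite because it is the
    -- reproducing kernel of `H`) and its reproducing kernel Hilbert space `H`
    (K : C(X × X, ℝ))
    {H : Type*} [NormedAddCommGroup H] [InnerProductSpace ℝ H] [CompleteSpace H] [RKHS ℝ H X ℝ]
    (hH : ∀ x y : X, RKHS.kernel H x y 1 = K (x, y))
    -- the distribution of the samples, with bounded outputs
    (ρ : Measure (X × ℝ)) [IsProbabilityMeasure ρ]
    (M : ℝ) (hM : 0 < M) (hbdd : ∀ᵐ z ∂ρ, |z.2| ≤ M)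
    -- the source condition
    (r : ℝ) (hr : 1 / 2 ≤ r) (hr' : r ≤ 1)
    (hsource : ∃ h : Lp ℝ 2 ρ.fst,
      DKRR.regressionFunction ρ =ᵐ[ρ.fst] ⇑(DKRR.opPower (DKRR.integralOperator K ρ.fst) r h))
    -- the effective dimension
    (s : ℝ) (hs : 0 < s) (hs' : s ≤ 1) (C₀ : ℝ) (hC₀ : 1 ≤ C₀)
    (heff : ∀ lam : ℝ, 0 < lam →
      DKRR.effectiveDimension (DKRR.integralOperator K ρ.fst) lam
        ≤ ENNReal.ofReal (C₀ * lam ^ (-s)))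
    (C₁ : ℝ) (hC₁ : 0 < C₁) :
    ∃ C₂ : ℝ, 0 < C₂ ∧
      ∀ (m : ℕ) (n : Fin m → ℕ), (∀ j, 1 ≤ n j) →
      ∀ N : ℕ, N = ∑ j, n j → 2 ≤ N →
      (m : ℝ) ≤ (N : ℝ) ^ (s / (2 * r + s)) * Real.log N ^ (-(8 * r)) →
      -- the samples are i.i.d. with law `ρ`
      Integrable (DKRR.dkrrError H ρ n fun j => DKRR.regParam C₁ r s N (n j))
          (Measure.pi fun _ => ρ) ∧
        ∫ D, DKRR.dkrrError H ρ n (fun j => DKRR.regParam C₁ r s N (n j)) D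
            ∂(Measure.pi fun _ => ρ)
          ≤ C₂ * (N : ℝ) ^ (-(2 * r / (2 * r + s))) := by

  obtain ⟨h, hh⟩ := hsource
  rw [DKRR.integralOperator_eq H hH] at hh
  obtain ⟨f, hf, hdec⟩ := DKRR.exists_source_decomposition (DKRR.inclusion H hH ρ.fst) hr hr' h
  have hreg : DKRR.regressionFunction ρ =ᵐ[ρ.fst] f := by
    rw [← hf] at hh
    exact hh.trans (DKRR.coeFn_inclusion H hH ρ.fst f)
  have hlog2 : 0 < Real.log 2 := Real.log_pos (by norm_num)
  set C := 1 + ‖K‖ / (C₁ * Real.log 2 ^ 4)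
  refine ⟨8 * C ^ 4 * ‖h‖ ^ 2 * (2 * C₁ ^ (2 * r))
    + 2 * (M + ‖DKRR.toContinuous H hH f‖) ^ 2 * (2 * C ^ 2 + 2) * (C₀ * C₁ ^ (-s)),
    by positivity, fun m n hn N hNn hN hm => ?_⟩
  have hlam : ∀ j, 0 < DKRR.regParam C₁ r s N (n j) := fun j =>
    DKRR.regParam_pos hC₁ (hn j) hN
  have hN0 : ∑ j, n j ≠ 0 := by omega
  refine ⟨DKRR.integrable_dkrrError hH hbdd hreg hn hN0 hlam, ?_⟩
  have hC : ∀ j, 1 + ‖K‖ / (n j * DKRR.regParam C₁ r s N (n j)) ≤ C := fun j => by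
    have := DKRR.le_mul_regParam (r := r) (s := s) hC₁ (hn j) hN
    simp only [C]
    gcongr
  refine (DKRR.integral_dkrrError_le hH hbdd hreg hn hN0 hlam hC hdec
    (fun j => by have := hlam j; positivity) (fun j => heff _ (hlam j))).trans ?_
  rw [← hNn]
  have h1 := DKRR.sum_mul_regParam_rpow_le hC₁ hr hs hn hNn hN hm
  have h2 := DKRR.sum_sq_mul_regParam_rpow_le (C₀ := C₀) hC₁ hr hs hn hNn hN (by linarith)
  calc _ ≤ 8 * C ^ 4 * ‖h‖ ^ 2 * (2 * C₁ ^ (2 * r) * (N : ℝ) ^ (-(2 * r / (2 * r + s))))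
      + 2 * (M + ‖DKRR.toContinuous H hH f‖) ^ 2 * (2 * C ^ 2 + 2)
        * (C₀ * C₁ ^ (-s) * (N : ℝ) ^ (-(2 * r / (2 * r + s)))) := by gcongr
    _ = _ := by ring
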